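/- Let $n\ge 1$, let $\alpha,\beta,\gamma_1,\dots,\gamma_n$ be nonzero complex numbers, and let $\{e_I\}_{I=(i_1,\dots,i_n)\in\{0,1\}^n}$, $e_I=e_{i_1}\otimes\cdots\otimes e_{i_n}$, be the standard basis of $\mathbb{C}^{2^n}=(\mathbb{C}^2)^{\otimes n}$. Put $|I|=i_1+\cdots+i_n$. For $1\le k\le n$ let $$M_k=E_2\otimes\cdots\otimes \underset{k\text{-th}}{G_k}\otimes\cdots\otimes E_2,\qquad G_k=\begin{pmatrix}1&-\gamma_k^{-1}\\0&\gamma_k^{-1}\end{pmatrix},$$ and let $M_0=E_{2^n}-N_0$, where the row of $N_0$ with index $(1,\dots,1)$ is ${}^tv$, all other rows of $N_0$ are $0$, and $$v_{(0,\dots,0)}=(-1)^n\frac{(\alpha-1)(\beta-1)\prod_k\gamma_k}{\alpha\beta},\qquad v_I=(-1)^{n+|I|}\frac{\bigl(\alpha\beta+(-1)^{|I|}\prod_k\gamma_k^{i_k}\bigr)\prod_k\gamma_k^{1-i_k}}{\alpha\beta}\quad(I\ne(0,\dots,0)).$$ These are the circuit matrices of Lauricella's system $E_C(a,b,c)$ with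 $\alpha=e^{2\pi\sqrt{-1}a}$, $\beta=e^{2\pi\sqrt{-1}b}$, $\gamma_k=e^{2\pi\sqrt{-1}c_k}$. Let $\mathrm{Mon}\subset \mathrm{GL}_{2^n}(\mathbb{C})$ be the group generated by $M_0,M_1,\dots,M_n$, let $\mathrm{Ref}\subset\mathrm{Mon}$ be the subgroup generated by all $gM_0g^{-1}$ with $g\in\mathrm{Mon}$, let $\mathrm{Mon}^0$ be the connected component of the identity of $\mathrm{Mon}$ in the Zariski topology, and let $$\delta_0=(-1)^{n+1}\frac{\gamma_1\cdots\gamma_n}{\alpha\beta}.$$ (i) $\mathrm{Ref}$ acts irreducibly on $\mathbb{C}^{2^n}$ if and only if $$\alpha\ne\prod_{k}\gamma_k^{i_k}\ \text{ and }\ \beta\neq\prod_{k}\gamma_k^{i_k}\qquad\text{for all } (i_1,\dots,i_n)\in\{0,1\}^n,$$ and at most one of the $n+1$ numbers $\gamma_1,\dots,\gamma_n,\alpha\beta^{-1}$ (counted with repetition) is $-1$. (ii) Suppose that $\mathrm{Ref}$ acts irreducibly on $\mathbb{C}^{2^n}$. In the case $n=1$ suppose moreover that $\delta_0\ne-1$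 or that neither of $\gamma_1$, $\alpha\beta^{-1}$ is $-1$. If $\mathrm{Mon}$ is infinite, then $\mathrm{Mon}^0$ acts irreducibly on $\mathbb{C}^{2^n}$. (iii) If $\mathrm{Ref}$ acts irreducibly on $\mathbb{C}^{2^n}$ and $\delta_0=1$, then $\mathrm{Mon}$ is infinite. -/

import Mathlib

open Matrix

namespace LauricellaFC

/-- The index set `{0,1}^n` of the basis `e_I = e_{i_1} ⊗ ⋯ ⊗ e_{i_n}` of
`ℂ^{2^n} = ℂ² ⊗ ⋯ ⊗ ℂ²`. -/
abbrev Idx (n : ℕ) : Type := Fin n → Fin 2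

/-- The matrix of `A_1 ⊗ ⋯ ⊗ A_n` in the basis `e_I`: its `(I, J)`-entry is `∏ j, (A_j)_{i_j, j_j}`. -/
def tensorMatrix {n : ℕ} (A : Fin n → Matrix (Fin 2) (Fin 2) ℂ) : Matrix (Idx n) (Idx n) ℂ :=
  fun I J => ∏ j, A j (I j) (J j)

/-- `E₂ ⊗ ⋯ ⊗ E₂ ⊗ A ⊗ E₂ ⊗ ⋯ ⊗ E₂`, with `A` in the `k`-th place. -/
def tensorAt {n : ℕ} (k : Fin n) (A : Matrix (Fin 2) (Fin 2) ℂ) : Matrix (Idx n) (Idx n) ℂ :=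
  tensorMatrix (Function.update 1 k A)

theorem tensorMatrix_mul {n : ℕ} (A B : Fin n → Matrix (Fin 2) (Fin 2) ℂ) :
    tensorMatrix A * tensorMatrix B = tensorMatrix (A * B) := by
  ext I J
  simp only [tensorMatrix, Matrix.mul_apply, Pi.mul_apply, ← Finset.prod_mul_distrib]
  rw [Finset.prod_univ_sum, Fintype.piFinset_univ]

theorem tensorMatrix_one {n : ℕ} :
    tensorMatrix (1 : Fin n → Matrix (Fin 2) (Fin 2) ℂ) = 1 := by
  ext I J
  by_cases h : I = J
  · subst h; simp [tensorMatrix]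
  · obtain ⟨j, hj⟩ := Function.ne_iff.mp h
    rw [Matrix.one_apply_ne h]
    exact Finset.prod_eq_zero (Finset.mem_univ j) (by simp [Matrix.one_apply_ne hj])

theorem tensorAt_mul {n : ℕ} (k : Fin n) (A B : Matrix (Fin 2) (Fin 2) ℂ) :
    tensorAt k A * tensorAt k B = tensorAt k (A * B) := by
  unfold tensorAt
  rw [tensorMatrix_mul]
  congr 1
  ext1 j
  by_cases h : j = k
  · subst h; simp
  · simp [h]

theorem tensorAt_one {n : ℕ} (k : Fin n) : tensorAt k (1 : Matrix (Fin 2) (Fin 2) ℂ) = 1 := by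
  unfold tensorAt
  rw [← tensorMatrix_one]
  congr 1
  exact Function.update_eq_self k 1

/-- The `2 × 2` matrix `G_k`, as a function of `γ_k`. -/
noncomputable def matG (g : ℂˣ) : Matrix (Fin 2) (Fin 2) ℂ :=
  !![1, -(g : ℂ)⁻¹; 0, (g : ℂ)⁻¹]

/-- The inverse of `G_k`. -/
def matGInv (g : ℂˣ) : Matrix (Fin 2) (Fin 2) ℂ :=
  !![1, 1; 0, (g : ℂ)]

theorem matG_mul_inv (g : ℂˣ) : matG g * matGInv g = 1 := by
  ext i j
  fin_cases i <;> fin_cases j <;> simp [matG, matGInv, Matrix.mul_apply, Fin.sum_univ_two]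

theorem matG_inv_mul (g : ℂˣ) : matGInv g * matG g = 1 := by
  ext i j
  fin_cases i <;> fin_cases j <;> simp [matG, matGInv, Matrix.mul_apply, Fin.sum_univ_two]

variable {n : ℕ}

/-- The circuit matrix `M_k`, `1 ≤ k ≤ n`, an element of `GL_{2^n}(ℂ)`. -/
noncomputable def circuitM (γ : Fin n → ℂˣ) (k : Fin n) : GL (Idx n) ℂ where
  val := tensorAt k (matG (γ k))
  inv := tensorAt k (matGInv (γ k))
  val_inv := by rw [tensorAt_mul, matG_mul_inv, tensorAt_one]
  inv_val := by rw [tensorAt_mul, matG_inv_mul, tensorAt_one]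

/-- `|I| = i_1 + ⋯ + i_n`. -/
def size (I : Idx n) : ℕ := ∑ k, (I k : ℕ)

/-- The vector `v` whose transpose is the last row (the row `(1,…,1)`) of `N_0`. -/
noncomputable def vecV (α β : ℂˣ) (γ : Fin n → ℂˣ) (I : Idx n) : ℂ :=
  if I = 0 then
    (-1) ^ n * (((α : ℂ) - 1) * ((β : ℂ) - 1) * ∏ k, (γ k : ℂ)) / ((α : ℂ) * β)
  else
    (-1) ^ (n + size I) *
      (((α : ℂ) * β + (-1) ^ size I * ∏ k, (γ k : ℂ) ^ (I k : ℕ)) *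
        ∏ k, (γ k : ℂ) ^ (1 - (I k : ℕ))) / ((α : ℂ) * β)

/-- The matrix `N_0`: its row `(1,…,1)` is `vᵗ` and its other rows vanish. -/
noncomputable def matN0 (α β : ℂˣ) (γ : Fin n → ℂˣ) : Matrix (Idx n) (Idx n) ℂ :=
  fun I J => if I = 1 then vecV α β γ J else 0

/-- `δ₀ = (-1)^{n+1} γ_1 ⋯ γ_n / (α β)`, the special eigenvalue of the reflection `M_0`. -/
noncomputable def delta0 (α β : ℂˣ) (γ : Fin n → ℂˣ) : ℂ :=
  (-1) ^ (n + 1) * (∏ k, (γ k : ℂ)) / ((α : ℂ) * β)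

theorem delta0_ne_zero (α β : ℂˣ) (γ : Fin n → ℂˣ) : delta0 α β γ ≠ 0 := by
  unfold delta0
  have : (∏ k, (γ k : ℂ)) ≠ 0 := Finset.prod_ne_zero_iff.mpr fun k _ => (γ k).ne_zero
  simp [this]

theorem vecV_one [NeZero n] (α β : ℂˣ) (γ : Fin n → ℂˣ) :
    vecV α β γ 1 = 1 - delta0 α β γ := by
  have h1 : (1 : Idx n) ≠ 0 := by
    intro h
    have := congrFun h (0 : Fin n)
    simp at this
  have hs : size (1 : Idx n) = n := by simp [size]
  have hα := α.ne_zero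
  have hβ := β.ne_zero
  have hn : ((-1 : ℂ) ^ n) * (-1) ^ n = 1 := by rw [← mul_pow]; simp
  unfold vecV delta0
  rw [if_neg h1, hs]
  simp only [Pi.one_apply, Fin.val_one, pow_one, Nat.sub_self, pow_zero, Finset.prod_const_one,
    mul_one, pow_add, hn, one_mul]
  field_simp
  ring

theorem matN0_mul_self [NeZero n] (α β : ℂˣ) (γ : Fin n → ℂˣ) :
    matN0 α β γ * matN0 α β γ = (1 - delta0 α β γ) • matN0 α β γ := by
  ext I J
  simp only [Matrix.mul_apply, Matrix.smul_apply, smul_eq_mul, matN0]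
  by_cases h : I = 1
  · simp [h, vecV_one]
  · simp [h]

/-- The circuit matrix `M_0 = E - N_0`, an element of `GL_{2^n}(ℂ)`. -/
noncomputable def circuitM0 [NeZero n] (α β : ℂˣ) (γ : Fin n → ℂˣ) : GL (Idx n) ℂ where
  val := 1 - matN0 α β γ
  inv := 1 + (delta0 α β γ)⁻¹ • matN0 α β γ
  val_inv := by
    have h := delta0_ne_zero α β γ
    have e : (delta0 α β γ)⁻¹ * (1 - delta0 α β γ) = (delta0 α β γ)⁻¹ - 1 := by
      rw [mul_sub, inv_mul_cancel₀ h, mul_one]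
    rw [sub_mul, one_mul, mul_add, mul_one, mul_smul_comm, matN0_mul_self, smul_smul, e, sub_smul,
      one_smul]
    abel
  inv_val := by
    have h := delta0_ne_zero α β γ
    have e : (delta0 α β γ)⁻¹ * (1 - delta0 α β γ) = (delta0 α β γ)⁻¹ - 1 := by
      rw [mul_sub, inv_mul_cancel₀ h, mul_one]
    rw [mul_sub, mul_one, add_mul, one_mul, smul_mul_assoc, matN0_mul_self, smul_smul, e, sub_smul,
      one_smul]
    abel

/-- The monodromy group `Mon`, generated by `M_0, M_1, …, M_n`. -/
noncomputable def Mon [NeZero n] (α β : ℂˣ) (γ : Fin n → ℂˣ) : Subgroup (GL (Idx n) ℂ) :=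
  Subgroup.closure (insert (circuitM0 α β γ) (Set.range (circuitM γ)))

/-- The reflection subgroup `Ref`, generated by the reflections `g M_0 g⁻¹` with `g ∈ Mon`. -/
noncomputable def Ref [NeZero n] (α β : ℂˣ) (γ : Fin n → ℂˣ) : Subgroup (GL (Idx n) ℂ) :=
  Subgroup.closure {h | ∃ g ∈ Mon α β γ, h = g * circuitM0 α β γ * g⁻¹}

/-- The condition (irr-αβγ). -/
def IrrCondition (α β : ℂˣ) (γ : Fin n → ℂˣ) : Prop :=
  ∀ I : Idx n, (α : ℂ) - ∏ k, (γ k : ℂ) ^ (I k : ℕ) ≠ 0 ∧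
    (β : ℂ) - ∏ k, (γ k : ℂ) ^ (I k : ℕ) ≠ 0

/-- At most one of the `n + 1` members of the list `γ_1, …, γ_n, α β⁻¹` is `-1`. The members are
indexed by `Option (Fin n)`, with `none` for `α β⁻¹`. -/
def AtMostOneNegOne (α β : ℂˣ) (γ : Fin n → ℂˣ) : Prop :=
  {i : Option (Fin n) | i.elim ((α : ℂ) * (β : ℂ)⁻¹) (fun k => (γ k : ℂ)) = -1}.Subsingleton

/-- A set `S` of invertible matrices acts irreducibly on `ℂ^ι`: the space is nonzero and the only
`S`-invariant subspaces are `0` and `ℂ^ι`. -/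
def ActsIrreducibly {ι : Type*} [Fintype ι] [DecidableEq ι] (S : Set (GL ι ℂ)) : Prop :=
  Nontrivial (ι → ℂ) ∧
    ∀ W : Submodule ℂ (ι → ℂ), (∀ g ∈ S, ∀ w ∈ W, (g : Matrix ι ι ℂ) *ᵥ w ∈ W) → W = ⊥ ∨ W = ⊤

/-- The Zariski topology on `GL_ι(ℂ)`: the nonvanishing loci of polynomials in the matrix entries
form a basis of open sets. (Since the determinant is invertible on `GL_ι(ℂ)`, allowing its inverse
in the polynomials gives the same sets.) -/
@[reducible] def zariskiTopology (ι : Type*) [Fintype ι] [DecidableEq ι] : TopologicalSpace (GL ι ℂ) :=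
  TopologicalSpace.generateFrom
    {U | ∃ p : MvPolynomial (ι × ι) ℂ,
      U = {g : GL ι ℂ | MvPolynomial.eval (fun ij => (g : Matrix ι ι ℂ) ij.1 ij.2) p ≠ 0}}

/-- The identity component `G⁰` of `G`: the connected component of `1` in `G`, for the topology
induced on `G` by the Zariski topology. -/
def identityComponent {ι : Type*} [Fintype ι] [DecidableEq ι] (G : Subgroup (GL ι ℂ)) :
    Set (GL ι ℂ) :=
  @connectedComponentIn (GL ι ℂ) (zariskiTopology ι) (G : Set (GL ι ℂ)) 1

end LauricellaFC

/-!
Write `V = ℂ^{2^n}`, `e = e_{(1,…,1)}`, so that `M_0 w = w - (v · w) e`. The commuting matrices `M_k`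
satisfy `(M_k - 1)(M_k - γ_k⁻¹) = 0`, and `e` is a cyclic vector for them (`eq_top_of_root_mem`).

*Irreducibility of `Mon`.* A nonzero `Mon`-invariant subspace contains a joint eigenvector `f_I` of the
`M_k`. Up to a nonzero factor `v · f_I` is `(α - ∏ γ_k^{i_k}) (β - ∏ γ_k^{i_k})`
(`vecV_dotProduct_jointEigvec`); if it does not vanish, the subspace contains `e` and is everything, and
if it vanishes, `f_I` spans an invariant line.

*Irreducibility of `Ref`.* If two of the numbers `γ_1, …, γ_n, α β⁻¹` are `-1`, an explicit non-scalar
involution commutes with `Ref` (`atMostOneNegOne_of_actsIrreducibly`). Conversely let `U` be a simple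
`Ref`-submodule. As `Ref` is normal in `Mon`, the translates `gU` are equal to `U` or meet it in `0`, and
`U` may be taken to contain `e`. An `M_k` that moves `U` has `γ_k = -1`, by its quadratic equation, and if
there is only one such `k`, then `v` vanishes on `M_k U`, which gives `α + β = 0`
(`actsIrreducibly_ref`).

*The identity component.* The Zariski topology is Noetherian, so `Mon⁰` is a normal subgroup `C` of
finite index (`exists_subgroup_identityComponent`). Suppose that `C` is reducible. A simple `C`-submodule
`W` that is moved by `M_0` meets `M_0 W` in `0`, while `M_0` fixes `W ∩ ker v` pointwise; hence `W` is a
line (`exists_weightVector_moved`), and `C` has simultaneous eigenvectors. If some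
weight space of `C` has dimension at least two, it meets every reflecting hyperplane, is therefore fixed
by all reflections, and `C` consists of scalars (`weightSpace_eq_top`); then `Mon` is finite
(`finite_mon_of_scalar`). Otherwise `Mon` permutes the lines of weight vectors, and `M_0` interchanges
two of them and fixes the others pointwise (`MonomialData`). By the quadratic equations `δ₀ = -1`, and an
`M_k` can move a line only if `γ_k = -1`, which happens for at most one `k`. Since `e` lies in the plane
of the two interchanged lines and is cyclic, the dimension is at most `4`; in dimension `4` the plane
would be invariant under `Ref`, and dimension `2` is the exceptional case with `n = 1` and `δ₀ = -1`.

If `δ₀ = 1`, then `M_0` is a transvection and has infinite order.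
-/

namespace LauricellaFC

/-! ### The connected component of the identity in a Noetherian topology -/

section Topology

open TopologicalSpace

variable {G : Type*} [Group G] [TopologicalSpace G]

theorem mul_mem_connectedComponentIn (hl : ∀ g : G, Continuous fun x => g * x) (M : Subgroup G)
    {g a b : G} (hg : g ∈ M) (h : b ∈ connectedComponentIn (M : Set G) a) :
    g * b ∈ connectedComponentIn (M : Set G) (g * a) := by
  have ha : a ∈ (M : Set G) := connectedComponentIn_nonempty_iff.mp ⟨b, h⟩
  refine ((isPreconnected_connectedComponentIn (x := a) (F := (M : Set G))).image
    (fun x => g * x) (hl g).continuousOn).subset_connectedComponentIn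
    ⟨a, mem_connectedComponentIn ha, rfl⟩ ?_ ⟨b, h, rfl⟩
  rintro _ ⟨x, hx, rfl⟩
  exact M.mul_mem hg (connectedComponentIn_subset _ _ hx)

/-- The connected component of `1` in a subgroup `M`, as a subgroup. Only the left translations are
assumed to be continuous, since for the Zariski topology `G` is not a topological group. -/
def componentSubgroup (hl : ∀ g : G, Continuous fun x => g * x) (M : Subgroup G) : Subgroup G where
  carrier := connectedComponentIn (M : Set G) 1
  one_mem' := mem_connectedComponentIn M.one_mem
  mul_mem' := by
    intro a b ha hb
    have haM : a ∈ M := connectedComponentIn_subset _ _ ha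
    have := mul_mem_connectedComponentIn hl M haM hb
    rw [mul_one] at this
    rwa [connectedComponentIn_eq ha]
  inv_mem' := by
    intro a ha
    have haM : a ∈ M := connectedComponentIn_subset _ _ ha
    have h1 : (1 : G) ∈ connectedComponentIn (M : Set G) a := by
      rw [← connectedComponentIn_eq ha]
      exact mem_connectedComponentIn M.one_mem
    simpa using mul_mem_connectedComponentIn hl M (M.inv_mem haM) h1

theorem componentSubgroup_le (hl : ∀ g : G, Continuous fun x => g * x) (M : Subgroup G) :
    componentSubgroup hl M ≤ M := connectedComponentIn_subset _ _

theorem conj_mem_componentSubgroup (hl : ∀ g : G, Continuous fun x => g * x)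
    (hr : ∀ g : G, Continuous fun x => x * g) (M : Subgroup G) {g c : G} (hg : g ∈ M)
    (hc : c ∈ componentSubgroup hl M) : g * c * g⁻¹ ∈ componentSubgroup hl M := by
  have h1 : IsPreconnected ((fun x => g * x * g⁻¹) '' connectedComponentIn (M : Set G) 1) :=
    isPreconnected_connectedComponentIn.image _ ((hr g⁻¹).comp (hl g)).continuousOn
  refine h1.subset_connectedComponentIn ⟨1, mem_connectedComponentIn M.one_mem, by simp⟩ ?_
    ⟨c, hc, rfl⟩
  rintro _ ⟨x, hx, rfl⟩
  exact M.mul_mem (M.mul_mem hg (connectedComponentIn_subset _ _ hx)) (M.inv_mem hg)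

/-- A Noetherian space has finitely many irreducible components, and each of them lies in one
coset of the connected component of `1`. -/
theorem componentSubgroup_relIndex_ne_zero [NoetherianSpace G]
    (hl : ∀ g : G, Continuous fun x => g * x) (M : Subgroup G) :
    (componentSubgroup hl M).relIndex M ≠ 0 := by
  have hfin : Finite (irreducibleComponents M) := by
    have : NoetherianSpace M := NoetherianSpace.set (M : Set G)
    exact (NoetherianSpace.finite_irreducibleComponents (α := M)).to_subtype
  have key : ∀ g h : M, irreducibleComponent g = irreducibleComponent h →
      g⁻¹ * h ∈ (componentSubgroup hl M).subgroupOf M := by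
    intro g h hgh
    have h1 : IsPreconnected (Subtype.val '' (irreducibleComponent g) : Set G) :=
      (isIrreducible_irreducibleComponent.isPreirreducible.isPreconnected).image _
        continuous_subtype_val.continuousOn
    have h2 : (h : G) ∈ connectedComponentIn (M : Set G) g := by
      refine h1.subset_connectedComponentIn ⟨g, mem_irreducibleComponent, rfl⟩ ?_
        ⟨h, by rw [hgh]; exact mem_irreducibleComponent, rfl⟩
      rintro _ ⟨x, -, rfl⟩
      exact x.2
    have h3 := mul_mem_connectedComponentIn hl M (M.inv_mem g.2) h2
    rw [inv_mul_cancel] at h3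
    exact h3
  have hq : Finite (M ⧸ (componentSubgroup hl M).subgroupOf M) := by
    refine Finite.of_injective (fun q => (⟨irreducibleComponent q.out,
      irreducibleComponent_mem_irreducibleComponents _⟩ : irreducibleComponents M)) ?_
    intro p q hpq
    have := key p.out q.out (congrArg Subtype.val hpq)
    rw [← QuotientGroup.out_eq' p, ← QuotientGroup.out_eq' q]
    exact QuotientGroup.eq.mpr this
  exact Subgroup.index_ne_zero_of_finite

end Topology

/-! ### The Zariski topology on the general linear group -/

section Zariski

variable {ι : Type*} [Fintype ι] [DecidableEq ι]

theorem zariskiTopology_eq_induced : zariskiTopology ι = TopologicalSpace.induced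
    (fun g : GL ι ℂ => MvPolynomial.pointToPoint (k := ℂ)
      (fun ij : ι × ι => (g : Matrix ι ι ℂ) ij.1 ij.2))
    PrimeSpectrum.zariskiTopology := by
  rw [PrimeSpectrum.isTopologicalBasis_basic_opens.eq_generateFrom, induced_generateFrom_eq]
  unfold zariskiTopology
  congr 1
  ext U
  simp only [Set.mem_ofPred_eq, Set.mem_image, Set.mem_range, exists_exists_eq_and]
  refine exists_congr fun p => ?_
  have : (fun g : GL ι ℂ => MvPolynomial.pointToPoint (k := ℂ)
      (fun ij : ι × ι => (g : Matrix ι ι ℂ) ij.1 ij.2)) ⁻¹' (PrimeSpectrum.basicOpen p : Set _) =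
      {g : GL ι ℂ | MvPolynomial.eval (fun ij => (g : Matrix ι ι ℂ) ij.1 ij.2) p ≠ 0} := by
    ext g
    simp [MvPolynomial.pointToPoint, MvPolynomial.aeval_eq_eval]
  rw [this, eq_comm]

theorem zariski_noetherianSpace : @TopologicalSpace.NoetherianSpace (GL ι ℂ) (zariskiTopology ι) :=
  @Topology.IsInducing.noetherianSpace _ _ _ (zariskiTopology ι) _ _
    (@Topology.IsInducing.mk _ _ (zariskiTopology ι) _ _ zariskiTopology_eq_induced)

theorem zariski_continuous_mul_left (g : GL ι ℂ) :
    @Continuous _ _ (zariskiTopology ι) (zariskiTopology ι) fun x : GL ι ℂ => g * x := by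
  rw [continuous_generateFrom_iff]
  rintro _ ⟨p, rfl⟩
  refine TopologicalSpace.isOpen_generateFrom_of_mem ⟨MvPolynomial.bind₁ (fun ij : ι × ι =>
    ∑ k, MvPolynomial.C ((g : Matrix ι ι ℂ) ij.1 k) * MvPolynomial.X (k, ij.2)) p, ?_⟩
  ext x
  simp only [← MvPolynomial.aeval_eq_eval, MvPolynomial.aeval_bind₁]
  simp [Matrix.mul_apply]

theorem zariski_continuous_mul_right (g : GL ι ℂ) :
    @Continuous _ _ (zariskiTopology ι) (zariskiTopology ι) fun x : GL ι ℂ => x * g := by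
  rw [continuous_generateFrom_iff]
  rintro _ ⟨p, rfl⟩
  refine TopologicalSpace.isOpen_generateFrom_of_mem ⟨MvPolynomial.bind₁ (fun ij : ι × ι =>
    ∑ k, MvPolynomial.X (ij.1, k) * MvPolynomial.C ((g : Matrix ι ι ℂ) k ij.2)) p, ?_⟩
  ext x
  simp only [← MvPolynomial.aeval_eq_eval, MvPolynomial.aeval_bind₁]
  simp [Matrix.mul_apply]

/-- The identity component of a linear group is the underlying set of a normal subgroup of finite
index. -/
theorem exists_subgroup_identityComponent (M : Subgroup (GL ι ℂ)) :
    ∃ C : Subgroup (GL ι ℂ), (C : Set (GL ι ℂ)) = identityComponent M ∧ C ≤ M ∧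
      (∀ g ∈ M, ∀ c ∈ C, g * c * g⁻¹ ∈ C) ∧ C.relIndex M ≠ 0 := by
  have := zariski_noetherianSpace (ι := ι)
  refine ⟨@componentSubgroup _ _ (zariskiTopology ι) zariski_continuous_mul_left M, rfl,
    @componentSubgroup_le _ _ (zariskiTopology ι) _ M,
    fun g hg c hc => @conj_mem_componentSubgroup _ _ (zariskiTopology ι) _
      zariski_continuous_mul_right M g c hg hc,
    @componentSubgroup_relIndex_ne_zero _ _ (zariskiTopology ι) this _ M⟩

end Zariski

/-! ### Invariant subspaces and their translates -/

section Stable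

variable {ι : Type*} [Fintype ι] [DecidableEq ι]

/-- The subspace `W` is invariant under the matrices in `S`. -/
def Stable (S : Set (GL ι ℂ)) (W : Submodule ℂ (ι → ℂ)) : Prop :=
  ∀ g ∈ S, ∀ w ∈ W, (g : Matrix ι ι ℂ) *ᵥ w ∈ W

/-- The subspace `gW`, encoded as the preimage of `W` under `g⁻¹`. -/
def translate (g : GL ι ℂ) (W : Submodule ℂ (ι → ℂ)) : Submodule ℂ (ι → ℂ) :=
  W.comap (Matrix.mulVecLin ((g⁻¹ : GL ι ℂ) : Matrix ι ι ℂ))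

/-- `W` is a simple module under `S`: a minimal nonzero `S`-invariant subspace. -/
def MinStable (S : Set (GL ι ℂ)) (W : Submodule ℂ (ι → ℂ)) : Prop :=
  W ≠ ⊥ ∧ Stable S W ∧ ∀ U ≤ W, Stable S U → U ≠ ⊥ → U = W

theorem coe_mulVec_mul (g h : GL ι ℂ) (w : ι → ℂ) :
    ((g * h : GL ι ℂ) : Matrix ι ι ℂ) *ᵥ w = (g : Matrix ι ι ℂ) *ᵥ ((h : Matrix ι ι ℂ) *ᵥ w) := by
  rw [Units.val_mul, mulVec_mulVec]

theorem inv_mulVec_mulVec (g : GL ι ℂ) (w : ι → ℂ) :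
    ((g⁻¹ : GL ι ℂ) : Matrix ι ι ℂ) *ᵥ ((g : Matrix ι ι ℂ) *ᵥ w) = w := by
  rw [← coe_mulVec_mul, inv_mul_cancel, Units.val_one, one_mulVec]

theorem mulVec_inv_mulVec (g : GL ι ℂ) (w : ι → ℂ) :
    (g : Matrix ι ι ℂ) *ᵥ (((g⁻¹ : GL ι ℂ) : Matrix ι ι ℂ) *ᵥ w) = w := by
  rw [← coe_mulVec_mul, mul_inv_cancel, Units.val_one, one_mulVec]

theorem mulVec_eq_zero_iff (g : GL ι ℂ) {w : ι → ℂ} :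
    (g : Matrix ι ι ℂ) *ᵥ w = 0 ↔ w = 0 := by
  refine ⟨fun h => ?_, fun h => by rw [h, mulVec_zero]⟩
  rw [← inv_mulVec_mulVec g w, h, mulVec_zero]

theorem mem_translate {g : GL ι ℂ} {W : Submodule ℂ (ι → ℂ)} {w : ι → ℂ} :
    w ∈ translate g W ↔ ((g⁻¹ : GL ι ℂ) : Matrix ι ι ℂ) *ᵥ w ∈ W := Iff.rfl

theorem mulVec_mem_translate {g : GL ι ℂ} {W : Submodule ℂ (ι → ℂ)} {w : ι → ℂ} :
    (g : Matrix ι ι ℂ) *ᵥ w ∈ translate g W ↔ w ∈ W := by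
  rw [mem_translate, inv_mulVec_mulVec]

theorem translate_mul (g h : GL ι ℂ) (W : Submodule ℂ (ι → ℂ)) :
    translate (g * h) W = translate g (translate h W) := by
  ext w
  rw [mem_translate, mem_translate, mem_translate, _root_.mul_inv_rev, coe_mulVec_mul]

theorem translate_one (W : Submodule ℂ (ι → ℂ)) : translate 1 W = W := by
  ext w
  rw [mem_translate, inv_one, Units.val_one, one_mulVec]

theorem translate_mono (g : GL ι ℂ) {U W : Submodule ℂ (ι → ℂ)} (h : U ≤ W) :
    translate g U ≤ translate g W := fun _ hw => h hw

theorem translate_ne_bot {g : GL ι ℂ} {W : Submodule ℂ (ι → ℂ)} (h : W ≠ ⊥) :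
    translate g W ≠ ⊥ := by
  obtain ⟨w, hw, h0⟩ := W.ne_bot_iff.mp h
  exact (Submodule.ne_bot_iff _).mpr ⟨_, mulVec_mem_translate.mpr hw,
    fun h => h0 ((mulVec_eq_zero_iff g).mp h)⟩

theorem Stable.translate {S : Set (GL ι ℂ)} {W : Submodule ℂ (ι → ℂ)} (hW : Stable S W)
    {g : GL ι ℂ} (hg : ∀ c ∈ S, g⁻¹ * c * g ∈ S) : Stable S (translate g W) := by
  intro c hc w hw
  have := hW _ (hg c hc) _ (mem_translate.mp hw)
  rwa [coe_mulVec_mul, coe_mulVec_mul, mulVec_inv_mulVec] at this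

theorem Stable.inf {S : Set (GL ι ℂ)} {U W : Submodule ℂ (ι → ℂ)} (hU : Stable S U)
    (hW : Stable S W) : Stable S (U ⊓ W) :=
  fun g hg w hw => ⟨hU g hg w hw.1, hW g hg w hw.2⟩

theorem MinStable.translate {S : Set (GL ι ℂ)} {W : Submodule ℂ (ι → ℂ)} (hW : MinStable S W)
    {g : GL ι ℂ} (hg : ∀ c ∈ S, g⁻¹ * c * g ∈ S) (hg' : ∀ c ∈ S, g * c * g⁻¹ ∈ S) :
    MinStable S (translate g W) := by
  refine ⟨translate_ne_bot hW.1, hW.2.1.translate hg, fun U hU hS h0 => ?_⟩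
  have h1 : LauricellaFC.translate g⁻¹ U = W := by
    refine hW.2.2 _ ?_ (hS.translate (by simpa using hg')) (translate_ne_bot h0)
    have := translate_mono g⁻¹ hU
    rwa [← translate_mul, inv_mul_cancel, translate_one] at this
  rw [← h1, ← translate_mul, mul_inv_cancel, translate_one]

/-- Two minimal invariant subspaces are equal as soon as they meet. -/
theorem MinStable.eq_of_mem {S : Set (GL ι ℂ)} {U W : Submodule ℂ (ι → ℂ)} (hU : MinStable S U)
    (hW : MinStable S W) {w : ι → ℂ} (h0 : w ≠ 0) (hwU : w ∈ U) (hwW : w ∈ W) : U = W := by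
  have hne : U ⊓ W ≠ ⊥ := (Submodule.ne_bot_iff _).mpr ⟨w, ⟨hwU, hwW⟩, h0⟩
  rw [← hU.2.2 _ inf_le_left (hU.2.1.inf hW.2.1) hne, hW.2.2 _ inf_le_right (hU.2.1.inf hW.2.1) hne]

theorem exists_minStable_le {S : Set (GL ι ℂ)} {W : Submodule ℂ (ι → ℂ)} (hW : Stable S W)
    (h0 : W ≠ ⊥) : ∃ U ≤ W, MinStable S U := by
  obtain ⟨U, hU, hmin⟩ := exists_minimal_le_of_wellFoundedLT
    (fun U : Submodule ℂ (ι → ℂ) => Stable S U ∧ U ≠ ⊥) W ⟨hW, h0⟩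
  exact ⟨U, hU, hmin.prop.2, hmin.prop.1, fun U' hU' hs h => (hmin.eq_of_le ⟨hs, h⟩ hU')⟩

/-- In finite dimension `gW ≤ W` forces `gW = W`. -/
theorem translate_eq_self {g : GL ι ℂ} {W : Submodule ℂ (ι → ℂ)}
    (hW : ∀ w ∈ W, (g : Matrix ι ι ℂ) *ᵥ w ∈ W) : translate g W = W := by
  have hle : W.map (Matrix.mulVecLin (g : Matrix ι ι ℂ)) ≤ W := by
    rintro _ ⟨w, hw, rfl⟩
    exact hW w hw
  have hinj : Function.Injective (Matrix.mulVecLin (g : Matrix ι ι ℂ)) := by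
    intro x y h
    have h' : (g : Matrix ι ι ℂ) *ᵥ x = (g : Matrix ι ι ℂ) *ᵥ y := h
    rw [← inv_mulVec_mulVec g x, h', inv_mulVec_mulVec]
  have heq : W.map (Matrix.mulVecLin (g : Matrix ι ι ℂ)) = W :=
    Submodule.eq_of_le_of_finrank_eq hle (Submodule.equivMapOfInjective _ hinj W).finrank_eq.symm
  ext w
  rw [mem_translate]
  constructor
  · intro h
    have := hW _ h
    rwa [mulVec_inv_mulVec] at this
  · intro h
    rw [← heq] at h
    obtain ⟨x, hx, rfl⟩ := h
    rw [mulVecLin_apply, inv_mulVec_mulVec]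
    exact hx

theorem translate_inv_eq {g : GL ι ℂ} {U W : Submodule ℂ (ι → ℂ)} (h : translate g U = W) :
    translate g⁻¹ W = U := by
  rw [← h, ← translate_mul, inv_mul_cancel, translate_one]

theorem mulVec_mem_of_translate_eq {g : GL ι ℂ} {U W : Submodule ℂ (ι → ℂ)}
    (h : translate g U = W) {w : ι → ℂ} (hw : w ∈ U) : (g : Matrix ι ι ℂ) *ᵥ w ∈ W :=
  h ▸ mulVec_mem_translate.mpr hw

/-- A subspace invariant under a set of matrices is invariant under the group it generates. -/
theorem stable_closure {S : Set (GL ι ℂ)} {W : Submodule ℂ (ι → ℂ)} (hW : Stable S W) :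
    Stable (Subgroup.closure S : Set (GL ι ℂ)) W := by
  have key : ∀ g ∈ Subgroup.closure S, translate g W = W := by
    intro g hg
    induction hg using Subgroup.closure_induction with
    | mem g hg => exact translate_eq_self (hW g hg)
    | one => exact translate_one W
    | mul g h _ _ h1 h2 => rw [translate_mul, h2, h1]
    | inv g _ h => exact translate_inv_eq h
  exact fun g hg w hw => mulVec_mem_of_translate_eq (key g hg) hw

end Stable

/-! ### The action of the circuit matrices -/

section Circuit

theorem eq_zero_or_eq_one : ∀ i : Fin 2, i = 0 ∨ i = 1 := by decide

variable {n : ℕ}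

theorem tensorAt_mulVec (k : Fin n) (A : Matrix (Fin 2) (Fin 2) ℂ) (w : Idx n → ℂ) (I : Idx n) :
    (tensorAt k A *ᵥ w) I = ∑ j, A (I k) j * w (Function.update I k j) := by
  symm
  rw [Matrix.mulVec, dotProduct]
  refine Finset.sum_of_injOn (fun j => Function.update I k j) ?_ (by simp) ?_ ?_
  · intro a _ b _ h
    simpa using congrFun h k
  · intro J _ hJ
    obtain ⟨i, hik, hi⟩ : ∃ i, i ≠ k ∧ I i ≠ J i := by
      by_contra! hcon
      refine hJ ⟨J k, by simp, ?_⟩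
      ext1 i
      by_cases h : i = k
      · subst h; simp
      · simp [h, hcon i h]
    rw [tensorAt, tensorMatrix, Finset.prod_eq_zero (Finset.mem_univ i), zero_mul]
    simp [hik, Matrix.one_apply_ne hi]
  · intro j _
    congr 1
    rw [tensorAt, tensorMatrix, Finset.prod_eq_single k]
    · simp
    · intro i _ hi
      simp [hi]
    · simp

/-- The matrix `M_k` in coordinates: components with `i_k = 0`. -/
theorem circuitM_mulVec_zero (γ : Fin n → ℂˣ) (k : Fin n) (w : Idx n → ℂ) (I : Idx n)
    (h : I k = 0) : ((circuitM γ k : GL (Idx n) ℂ) : Matrix _ _ ℂ).mulVec w I =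
      w I - (γ k : ℂ)⁻¹ * w (Function.update I k 1) := by
  have : Function.update I k 0 = I := by rw [← h, Function.update_eq_self]
  simp [circuitM, tensorAt_mulVec, matG, h, this]
  ring

/-- The matrix `M_k` in coordinates: components with `i_k = 1`. -/
theorem circuitM_mulVec_one (γ : Fin n → ℂˣ) (k : Fin n) (w : Idx n → ℂ) (I : Idx n)
    (h : I k = 1) : ((circuitM γ k : GL (Idx n) ℂ) : Matrix _ _ ℂ).mulVec w I =
      (γ k : ℂ)⁻¹ * w I := by
  have : Function.update I k 1 = I := by rw [← h, Function.update_eq_self]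
  simp [circuitM, tensorAt_mulVec, matG, h, this]

theorem circuitM_quadratic (γ : Fin n → ℂˣ) (k : Fin n) (w : Idx n → ℂ) :
    (circuitM γ k : Matrix (Idx n) (Idx n) ℂ) *ᵥ ((circuitM γ k : Matrix (Idx n) (Idx n) ℂ) *ᵥ w) =
      (1 + (γ k : ℂ)⁻¹) • ((circuitM γ k : Matrix (Idx n) (Idx n) ℂ) *ᵥ w) - (γ k : ℂ)⁻¹ • w := by
  ext I
  have h01 : I k = 0 ∨ I k = 1 := eq_zero_or_eq_one _
  rcases h01 with h | h
  · simp only [Pi.sub_apply, Pi.smul_apply, smul_eq_mul, circuitM_mulVec_zero γ k _ I h]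
    rw [circuitM_mulVec_one γ k _ (Function.update I k 1) (by simp)]
    ring
  · simp only [Pi.sub_apply, Pi.smul_apply, smul_eq_mul, circuitM_mulVec_one γ k _ I h]
    ring

theorem tensorAt_comm {k l : Fin n} (hkl : k ≠ l) (A B : Matrix (Fin 2) (Fin 2) ℂ) :
    tensorAt k A * tensorAt l B = tensorAt l B * tensorAt k A := by
  unfold tensorAt
  rw [tensorMatrix_mul, tensorMatrix_mul]
  congr 1
  ext1 j
  by_cases hk : j = k
  · subst hk; simp [hkl]
  · simp [hk]

theorem circuitM_comm (γ : Fin n → ℂˣ) (k l : Fin n) :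
    circuitM γ k * circuitM γ l = circuitM γ l * circuitM γ k := by
  by_cases hkl : k = l
  · rw [hkl]
  · ext1
    exact tensorAt_comm hkl _ _

/-- The root `e_{(1,…,1)}` of the reflection `M_0`. -/
def root (n : ℕ) : Idx n → ℂ := Pi.single 1 1

theorem single_update_zero_eq (γ : Fin n → ℂˣ) {k : Fin n} {J : Idx n} (hJ : J k = 1) :
    (Pi.single (Function.update J k 0) 1 : Idx n → ℂ) = Pi.single J 1 -
      (γ k : ℂ) • ((circuitM γ k : Matrix (Idx n) (Idx n) ℂ) *ᵥ Pi.single J 1) := by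
  ext I
  have h01 : I k = 0 ∨ I k = 1 := eq_zero_or_eq_one _
  have hγ := (γ k).ne_zero
  rcases h01 with hI | hI
  · have e1 : I ≠ J := by rintro rfl; simp [hI] at hJ
    have e2 : I = Function.update J k 0 ↔ Function.update I k 1 = J := by
      constructor
      · rintro rfl
        rw [Function.update_idem, ← hJ, Function.update_eq_self]
      · rintro rfl
        rw [Function.update_idem, ← hI, Function.update_eq_self]
    simp only [Pi.sub_apply, Pi.smul_apply, smul_eq_mul, circuitM_mulVec_zero γ k _ I hI,
      Pi.single_apply, e1, if_false, e2]
    split_ifs <;> field_simp <;> simp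
  · have e1 : I ≠ Function.update J k 0 := by rintro rfl; simp at hI
    simp only [Pi.sub_apply, Pi.smul_apply, smul_eq_mul, circuitM_mulVec_one γ k _ I hI,
      Pi.single_apply, e1, if_false]
    split_ifs <;> field_simp <;> simp

theorem single_update_zero_mem (γ : Fin n → ℂˣ) {W : Submodule ℂ (Idx n → ℂ)} {k : Fin n}
    (hW : ∀ w ∈ W, (circuitM γ k : Matrix (Idx n) (Idx n) ℂ) *ᵥ w ∈ W) {J : Idx n} (hJ : J k = 1)
    (h : (Pi.single J 1 : Idx n → ℂ) ∈ W) :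
    (Pi.single (Function.update J k 0) 1 : Idx n → ℂ) ∈ W := by
  rw [single_update_zero_eq γ hJ]
  exact W.sub_mem h (W.smul_mem _ (hW _ h))

/-- If `W` contains the root `e` and is invariant under `M_k`, `k ∈ s`, then it contains all `e_J`
such that `J` is `1` off `s`. -/
theorem single_mem_of_root_mem (γ : Fin n → ℂˣ) {W : Submodule ℂ (Idx n → ℂ)} (s : Finset (Fin n))
    (hW : ∀ k ∈ s, ∀ w ∈ W, (circuitM γ k : Matrix (Idx n) (Idx n) ℂ) *ᵥ w ∈ W)
    (h : root n ∈ W) (J : Idx n) (hJ : ∀ k ∉ s, J k = 1) : (Pi.single J 1 : Idx n → ℂ) ∈ W := by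
  induction s using Finset.induction_on generalizing J with
  | empty =>
    have : J = 1 := funext fun k => hJ k (by simp)
    rw [this]
    exact h
  | insert k s hk ih =>
    have h01 : J k = 0 ∨ J k = 1 := eq_zero_or_eq_one _
    have ih' := ih fun l hl => hW l (Finset.mem_insert_of_mem hl)
    rcases h01 with h0 | h0
    · have h1 := ih' (Function.update J k 1) (fun l hl => by
        by_cases hlk : l = k
        · subst hlk; simp
        · rw [Function.update_of_ne hlk]; exact hJ l (by simp [hlk, hl]))
      have := single_update_zero_mem γ (hW k (Finset.mem_insert_self _ _)) (by simp) h1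
      rwa [Function.update_idem, ← h0, Function.update_eq_self] at this
    · refine ih' J fun l hl => ?_
      by_cases hlk : l = k
      · rw [hlk, h0]
      · exact hJ l (by simp [hlk, hl])

/-- The root `e` is a cyclic vector for the commuting matrices `M_1, …, M_n`. -/
theorem eq_top_of_root_mem (γ : Fin n → ℂˣ) {W : Submodule ℂ (Idx n → ℂ)}
    (hW : ∀ k, ∀ w ∈ W, (circuitM γ k : Matrix (Idx n) (Idx n) ℂ) *ᵥ w ∈ W)
    (h : root n ∈ W) : W = ⊤ := by
  rw [eq_top_iff, ← (Pi.basisFun ℂ (Idx n)).span_eq, Submodule.span_le]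
  rintro _ ⟨J, rfl⟩
  rw [Pi.basisFun_apply]
  exact single_mem_of_root_mem γ Finset.univ (fun k _ => hW k) h J (by simp)

variable [NeZero n]

theorem circuitM0_mulVec (α β : ℂˣ) (γ : Fin n → ℂˣ) (w : Idx n → ℂ) :
    (circuitM0 α β γ : Matrix (Idx n) (Idx n) ℂ) *ᵥ w = w - (vecV α β γ ⬝ᵥ w) • root n := by
  change (1 - matN0 α β γ) *ᵥ w = _
  rw [sub_mulVec, one_mulVec]
  congr 1
  ext I
  by_cases h : I = 1 <;> simp [matN0, mulVec, dotProduct, root, h]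

theorem vecV_dotProduct_root (α β : ℂˣ) (γ : Fin n → ℂˣ) :
    vecV α β γ ⬝ᵥ root n = 1 - delta0 α β γ := by
  rw [root, dotProduct_single, vecV_one, mul_one]

/-- If `v · (g⁻¹ w) ≠ 0` for some `w` in a subspace invariant under the reflection `g M_0 g⁻¹`, then
the subspace contains the root `g e` of that reflection. -/
theorem mulVec_root_mem {α β : ℂˣ} {γ : Fin n → ℂˣ} {W : Submodule ℂ (Idx n → ℂ)} {g : GL (Idx n) ℂ}
    {w : Idx n → ℂ} (hw : w ∈ W)
    (hr : ((g * circuitM0 α β γ * g⁻¹ : GL (Idx n) ℂ) : Matrix (Idx n) (Idx n) ℂ) *ᵥ w ∈ W)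
    (hv : vecV α β γ ⬝ᵥ (((g⁻¹ : GL (Idx n) ℂ) : Matrix (Idx n) (Idx n) ℂ) *ᵥ w) ≠ 0) :
    (g : Matrix (Idx n) (Idx n) ℂ) *ᵥ root n ∈ W := by
  rw [coe_mulVec_mul, coe_mulVec_mul, circuitM0_mulVec, mulVec_sub, mulVec_inv_mulVec,
    mulVec_smul] at hr
  have := W.sub_mem hw hr
  rw [sub_sub_cancel] at this
  exact (W.smul_mem_iff hv).mp this

end Circuit

/-! ### Joint eigenvectors and irreducibility of the monodromy group -/

section Eigenvectors

variable {n : ℕ}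

theorem sum_prod_eq (F : Fin n → Fin 2 → ℂ) :
    ∑ J : Idx n, ∏ k, F k (J k) = ∏ k, (F k 0 + F k 1) := by
  simp only [← Fin.sum_univ_two]
  rw [Finset.prod_univ_sum, Fintype.piFinset_univ]

/-- The ratio of the two coordinates of the eigenvector of `G_k` indexed by `i`: the eigenvector is
`e_0` for `i = 0` (eigenvalue `1`) and `e_0 + (γ_k - 1) e_1` for `i = 1` (eigenvalue `γ_k⁻¹`). -/
noncomputable def eigRatio (g : ℂˣ) (i : Fin 2) : ℂ := if i = 0 then 0 else (g : ℂ) - 1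

/-- The joint eigenvector of `M_1, …, M_n` indexed by `I`, a tensor product of eigenvectors of the
`G_k`. If some `γ_k` is `1`, several indices give the same vector. -/
noncomputable def jointEigvec (γ : Fin n → ℂˣ) (I : Idx n) : Idx n → ℂ :=
  fun J => ∏ k, if J k = 0 then 1 else eigRatio (γ k) (I k)

theorem jointEigvec_zero (γ : Fin n → ℂˣ) (I : Idx n) : jointEigvec γ I 0 = 1 := by
  simp [jointEigvec]

theorem jointEigvec_update_one (γ : Fin n → ℂˣ) (I J : Idx n) {k : Fin n} (h : J k = 0) :
    jointEigvec γ I (Function.update J k 1) = eigRatio (γ k) (I k) * jointEigvec γ I J := by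
  unfold jointEigvec
  rw [← Finset.mul_prod_erase _ _ (Finset.mem_univ k), ← Finset.mul_prod_erase Finset.univ
    (fun l => if J l = 0 then (1 : ℂ) else eigRatio (γ l) (I l)) (Finset.mem_univ k)]
  have : ∀ l ∈ Finset.univ.erase k, (if Function.update J k 1 l = 0 then (1 : ℂ) else
      eigRatio (γ l) (I l)) = if J l = 0 then (1 : ℂ) else eigRatio (γ l) (I l) := by
    intro l hl
    rw [Function.update_of_ne (Finset.ne_of_mem_erase hl)]
  rw [Finset.prod_congr rfl this]
  simp [h]

theorem circuitM_mulVec_jointEigvec (γ : Fin n → ℂˣ) (I : Idx n) (k : Fin n) :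
    (circuitM γ k : Matrix (Idx n) (Idx n) ℂ) *ᵥ jointEigvec γ I =
      (if I k = 0 then 1 else (γ k : ℂ)⁻¹) • jointEigvec γ I := by
  have hγ := (γ k).ne_zero
  ext J
  rcases eq_zero_or_eq_one (J k) with hJ | hJ
  · rw [circuitM_mulVec_zero γ k _ J hJ, jointEigvec_update_one γ I J hJ, Pi.smul_apply,
      smul_eq_mul, eigRatio]
    split_ifs
    · ring
    · field_simp
      ring
  · have h0 : Function.update (Function.update J k 0) k 1 = J := by
      rw [Function.update_idem, ← hJ, Function.update_eq_self]
    have h1 := jointEigvec_update_one γ I (Function.update J k 0) (k := k) (by simp)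
    rw [h0] at h1
    rw [circuitM_mulVec_one γ k _ J hJ, Pi.smul_apply, smul_eq_mul]
    split_ifs with hI
    · simp [h1, eigRatio, hI]
    · rfl

/-- Matrices satisfying commuting quadratic equations have a joint eigenvector in every nonzero
invariant subspace, one equation after the other. -/
theorem exists_joint_eigenvector (γ : Fin n → ℂˣ) {W : Submodule ℂ (Idx n → ℂ)} (h0 : W ≠ ⊥)
    (hW : ∀ k, ∀ w ∈ W, (circuitM γ k : Matrix (Idx n) (Idx n) ℂ) *ᵥ w ∈ W)
    (s : Finset (Fin n)) : ∃ w ∈ W, w ≠ 0 ∧ ∀ k ∈ s,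
      (circuitM γ k : Matrix (Idx n) (Idx n) ℂ) *ᵥ w = w ∨
      (circuitM γ k : Matrix (Idx n) (Idx n) ℂ) *ᵥ w = (γ k : ℂ)⁻¹ • w := by
  induction s using Finset.induction_on with
  | empty =>
    obtain ⟨w, hw, h⟩ := W.ne_bot_iff.mp h0
    exact ⟨w, hw, h, by simp⟩
  | insert k s _ ih =>
    obtain ⟨w, hw, hw0, h⟩ := ih
    by_cases hk : (circuitM γ k : Matrix (Idx n) (Idx n) ℂ) *ᵥ w = w
    · refine ⟨w, hw, hw0, fun l hl => ?_⟩
      rcases Finset.mem_insert.mp hl with rfl | hl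
      · exact Or.inl hk
      · exact h l hl
    · refine ⟨(circuitM γ k : Matrix (Idx n) (Idx n) ℂ) *ᵥ w - w,
        W.sub_mem (hW k w hw) hw, sub_ne_zero.mpr hk, fun l hl => ?_⟩
      rcases Finset.mem_insert.mp hl with rfl | hl
      · right
        rw [mulVec_sub, circuitM_quadratic]
        module
      · have hc : (circuitM γ l : Matrix (Idx n) (Idx n) ℂ) *ᵥ
            ((circuitM γ k : Matrix (Idx n) (Idx n) ℂ) *ᵥ w) =
            (circuitM γ k : Matrix (Idx n) (Idx n) ℂ) *ᵥ
            ((circuitM γ l : Matrix (Idx n) (Idx n) ℂ) *ᵥ w) := by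
          rw [← coe_mulVec_mul, circuitM_comm, coe_mulVec_mul]
        rw [mulVec_sub, hc]
        rcases h l hl with h | h <;> rw [h]
        · exact Or.inl rfl
        · right
          rw [mulVec_smul, smul_sub]

theorem eq_smul_jointEigvec (γ : Fin n → ℂˣ) {w : Idx n → ℂ}
    (h : ∀ k, (circuitM γ k : Matrix (Idx n) (Idx n) ℂ) *ᵥ w = w ∨
      (circuitM γ k : Matrix (Idx n) (Idx n) ℂ) *ᵥ w = (γ k : ℂ)⁻¹ • w) :
    ∃ I, w = w 0 • jointEigvec γ I := by
  have hI : ∀ k, ∃ i : Fin 2, ∀ J : Idx n, J k = 1 →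
      w J = eigRatio (γ k) i * w (Function.update J k 0) := by
    intro k
    have hγ := (γ k).ne_zero
    rcases h k with h | h
    · refine ⟨0, fun J hJ => ?_⟩
      have := congrFun h (Function.update J k 0)
      rw [circuitM_mulVec_zero γ k _ _ (by simp), Function.update_idem, ← hJ,
        Function.update_eq_self] at this
      simpa [eigRatio] using this
    · refine ⟨1, fun J hJ => ?_⟩
      have := congrFun h (Function.update J k 0)
      rw [circuitM_mulVec_zero γ k _ _ (by simp), Function.update_idem, ← hJ,
        Function.update_eq_self, Pi.smul_apply, smul_eq_mul] at this
      field_simp at this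
      simp only [eigRatio, one_ne_zero, if_false]
      linear_combination -this
  choose I hI using hI
  refine ⟨I, ?_⟩
  have key : ∀ (s : Finset (Fin n)) (J : Idx n), (∀ k ∉ s, J k = 0) →
      w J = (∏ k ∈ s, if J k = 0 then 1 else eigRatio (γ k) (I k)) * w 0 := by
    intro s
    induction s using Finset.induction_on with
    | empty =>
      intro J hJ
      have : J = 0 := funext fun k => hJ k (by simp)
      simp [this]
    | insert k s hk ih =>
      intro J hJ
      rw [Finset.prod_insert hk]
      rcases eq_zero_or_eq_one (J k) with h0 | h0
      · rw [if_pos h0, one_mul]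
        refine ih J fun l hl => ?_
        by_cases hlk : l = k
        · rw [hlk, h0]
        · exact hJ l (by simp [hlk, hl])
      · rw [hI k J h0, if_neg (by simp [h0]), ih (Function.update J k 0), mul_assoc]
        · congr 2
          refine Finset.prod_congr rfl fun l hl => ?_
          rw [Function.update_of_ne (by rintro rfl; exact hk hl)]
        · intro l hl
          by_cases hlk : l = k
          · subst hlk; simp
          · rw [Function.update_of_ne hlk]; exact hJ l (by simp [hlk, hl])
  ext J
  rw [key Finset.univ J (by simp), Pi.smul_apply, smul_eq_mul, mul_comm]
  rfl

/-- The exceptional form of `v` at the index `0` appears as a correction term. -/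
theorem vecV_eq (α β : ℂˣ) (γ : Fin n → ℂˣ) (J : Idx n) :
    vecV α β γ J = (-1) ^ n / ((α : ℂ) * β) *
      ((α : ℂ) * β * ∏ k, ((-1) ^ (J k : ℕ) * (γ k : ℂ) ^ (1 - (J k : ℕ))) + ∏ k, (γ k : ℂ) -
        if J = 0 then ((α : ℂ) + β) * ∏ k, (γ k : ℂ) else 0) := by
  have hα := α.ne_zero
  have hβ := β.ne_zero
  unfold vecV
  split_ifs with h
  · subst h
    simp
    field_simp
    ring
  · have h1 : ∏ k, ((-1 : ℂ) ^ (J k : ℕ) * (γ k : ℂ) ^ (1 - (J k : ℕ))) =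
        (-1) ^ size J * ∏ k, (γ k : ℂ) ^ (1 - (J k : ℕ)) := by
      rw [Finset.prod_mul_distrib, Finset.prod_pow_eq_pow_sum, size]
    have h2 : ∏ k, (γ k : ℂ) =
        (∏ k, (γ k : ℂ) ^ (J k : ℕ)) * ∏ k, (γ k : ℂ) ^ (1 - (J k : ℕ)) := by
      rw [← Finset.prod_mul_distrib]
      refine Finset.prod_congr rfl fun k _ => ?_
      rcases eq_zero_or_eq_one (J k) with h | h <;> simp [h]
    have h3 : ((-1 : ℂ) ^ size J) * (-1) ^ size J = 1 := by rw [← mul_pow]; simp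
    rw [h1, h2, pow_add]
    linear_combination ((-1) ^ n / ((α : ℂ) * β) * (∏ k, (γ k : ℂ) ^ (J k : ℕ)) *
      ∏ k, (γ k : ℂ) ^ (1 - (J k : ℕ))) * h3

/-- The functional `v` factors on the joint eigenvectors; this is where the numbers
`α - ∏ γ_k^{i_k}` and `β - ∏ γ_k^{i_k}` come from. -/
theorem vecV_dotProduct_jointEigvec (α β : ℂˣ) (γ : Fin n → ℂˣ) (I : Idx n) :
    vecV α β γ ⬝ᵥ jointEigvec γ I = (-1) ^ n / ((α : ℂ) * β) *
      (∏ k, (γ k : ℂ) ^ (1 - (I k : ℕ))) *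
      (((α : ℂ) - ∏ k, (γ k : ℂ) ^ (I k : ℕ)) * ((β : ℂ) - ∏ k, (γ k : ℂ) ^ (I k : ℕ))) := by
  have e1 : ∑ J : Idx n, (∏ k, ((-1) ^ (J k : ℕ) * (γ k : ℂ) ^ (1 - (J k : ℕ)))) *
      jointEigvec γ I J = ∏ k, (γ k : ℂ) ^ (1 - (I k : ℕ)) := by
    simp only [jointEigvec, ← Finset.prod_mul_distrib]
    rw [sum_prod_eq (fun k j => ((-1) ^ (j : ℕ) * (γ k : ℂ) ^ (1 - (j : ℕ))) *
      if j = 0 then 1 else eigRatio (γ k) (I k))]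
    refine Finset.prod_congr rfl fun k _ => ?_
    rcases eq_zero_or_eq_one (I k) with h | h <;> simp [h, eigRatio]
  have e2 : ∑ J : Idx n, jointEigvec γ I J = ∏ k, (γ k : ℂ) ^ (I k : ℕ) := by
    simp only [jointEigvec]
    rw [sum_prod_eq (fun k j => if j = 0 then 1 else eigRatio (γ k) (I k))]
    refine Finset.prod_congr rfl fun k _ => ?_
    rcases eq_zero_or_eq_one (I k) with h | h <;> simp [h, eigRatio]
  have h2 : ∏ k, (γ k : ℂ) =
      (∏ k, (γ k : ℂ) ^ (I k : ℕ)) * ∏ k, (γ k : ℂ) ^ (1 - (I k : ℕ)) := by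
    rw [← Finset.prod_mul_distrib]
    refine Finset.prod_congr rfl fun k _ => ?_
    rcases eq_zero_or_eq_one (I k) with h | h <;> simp [h]
  simp only [dotProduct, vecV_eq, mul_assoc, ← Finset.mul_sum]
  simp only [sub_mul, add_mul, Finset.sum_sub_distrib, Finset.sum_add_distrib, ← Finset.mul_sum,
    mul_assoc, e1, e2, ite_mul, zero_mul, Finset.sum_ite_eq', Finset.mem_univ, if_true,
    jointEigvec_zero]
  rw [h2]
  ring

theorem root_ne_zero : root n ≠ 0 := by simp [root]

variable [NeZero n]

/-- If `v` vanishes on no joint eigenvector of `M_1, …, M_n`, then every nonzero `Mon`-invariant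
subspace contains the root `e`, hence everything. -/
theorem actsIrreducibly_mon {α β : ℂˣ} {γ : Fin n → ℂˣ} (h : IrrCondition α β γ) :
    ActsIrreducibly (Mon α β γ : Set (GL (Idx n) ℂ)) := by
  refine ⟨inferInstance, fun W hW => or_iff_not_imp_left.mpr fun h0 => ?_⟩
  have hM : ∀ k, ∀ w ∈ W, (circuitM γ k : Matrix (Idx n) (Idx n) ℂ) *ᵥ w ∈ W := fun k =>
    hW _ (Subgroup.subset_closure (Set.mem_insert_of_mem _ ⟨k, rfl⟩))
  obtain ⟨w, hw, hw0, he⟩ := exists_joint_eigenvector γ h0 hM Finset.univ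
  obtain ⟨I, hI⟩ := eq_smul_jointEigvec γ fun k => he k (Finset.mem_univ k)
  have hv : vecV α β γ ⬝ᵥ w ≠ 0 := by
    rw [hI, dotProduct_smul, vecV_dotProduct_jointEigvec, smul_eq_mul]
    have h1 : w 0 ≠ 0 := fun h => hw0 (by rw [hI, h, zero_smul])
    have h2 : ∏ k, (γ k : ℂ) ^ (1 - (I k : ℕ)) ≠ 0 :=
      Finset.prod_ne_zero_iff.mpr fun k _ => pow_ne_zero _ (γ k).ne_zero
    have h3 := mul_ne_zero α.ne_zero β.ne_zero
    exact mul_ne_zero h1 (mul_ne_zero (mul_ne_zero (div_ne_zero (by simp) h3) h2)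
      (mul_ne_zero (h I).1 (h I).2))
  refine eq_top_of_root_mem γ hM ?_
  have h1 := hW _ (Subgroup.subset_closure (Set.mem_insert _ _)) w hw
  rw [circuitM0_mulVec] at h1
  have h2 := W.sub_mem hw h1
  rw [sub_sub_cancel] at h2
  exact (W.smul_mem_iff hv).mp h2

theorem circuitM0_mem_mon (α β : ℂˣ) (γ : Fin n → ℂˣ) : circuitM0 α β γ ∈ Mon α β γ :=
  Subgroup.subset_closure (Set.mem_insert _ _)

theorem circuitM_mem_mon (α β : ℂˣ) (γ : Fin n → ℂˣ) (k : Fin n) : circuitM γ k ∈ Mon α β γ :=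
  Subgroup.subset_closure (Set.mem_insert_of_mem _ ⟨k, rfl⟩)

theorem ref_le_mon (α β : ℂˣ) (γ : Fin n → ℂˣ) : Ref α β γ ≤ Mon α β γ := by
  refine (Subgroup.closure_le _).mpr ?_
  rintro _ ⟨g, hg, rfl⟩
  exact mul_mem (mul_mem hg (circuitM0_mem_mon α β γ)) (inv_mem hg)

theorem one_ne_zero_idx : (1 : Idx n) ≠ 0 := by
  intro h
  simpa using congrFun h (0 : Fin n)

theorem irrCondition_of_actsIrreducibly {α β : ℂˣ} {γ : Fin n → ℂˣ}
    (h : ActsIrreducibly (Mon α β γ : Set (GL (Idx n) ℂ))) : IrrCondition α β γ := by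
  intro I
  by_contra hcon
  have hv : vecV α β γ ⬝ᵥ jointEigvec γ I = 0 := by
    rw [vecV_dotProduct_jointEigvec]
    by_cases h1 : (α : ℂ) - ∏ k, (γ k : ℂ) ^ (I k : ℕ) = 0
    · rw [h1, zero_mul, mul_zero]
    · have h2 : (β : ℂ) - ∏ k, (γ k : ℂ) ^ (I k : ℕ) = 0 := by
        by_contra h2
        exact hcon ⟨h1, h2⟩
      rw [h2, mul_zero, mul_zero]
  have hst : Stable (Mon α β γ : Set (GL (Idx n) ℂ)) (ℂ ∙ jointEigvec γ I) := by
    refine stable_closure ?_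
    rintro g (rfl | ⟨k, rfl⟩) w hw
    · obtain ⟨c, rfl⟩ := Submodule.mem_span_singleton.mp hw
      rw [circuitM0_mulVec, dotProduct_smul, hv, smul_zero, zero_smul, sub_zero]
      exact hw
    · obtain ⟨c, rfl⟩ := Submodule.mem_span_singleton.mp hw
      rw [mulVec_smul, circuitM_mulVec_jointEigvec, smul_comm]
      exact Submodule.smul_mem _ _ hw
  rcases h.2 _ hst with h0 | h0
  · have h1 := Submodule.span_singleton_eq_bot.mp h0
    simpa [jointEigvec_zero] using congrFun h1 0
  · obtain ⟨c, hc⟩ := Submodule.mem_span_singleton.mp (h0 ▸ Submodule.mem_top (x := root n))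
    have h1 := congrFun hc 0
    rw [Pi.smul_apply, jointEigvec_zero, root, Pi.single_eq_of_ne one_ne_zero_idx.symm,
      smul_eq_mul, mul_one] at h1
    rw [h1, zero_smul] at hc
    exact root_ne_zero hc.symm

end Eigenvectors

/-! ### Irreducibility of the reflection subgroup -/

section ReflectionSubgroup

variable {n : ℕ}

/-- An involution fixing `e_1` and anticommuting with `G_k` when `γ_k = -1`. -/
def matR : Matrix (Fin 2) (Fin 2) ℂ := !![-1, 0; 2, 1]

theorem tensorAt_neg (k : Fin n) (A : Matrix (Fin 2) (Fin 2) ℂ) :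
    tensorAt k (-A) = -tensorAt k A := by
  rw [← neg_one_smul ℂ A, ← neg_one_smul ℂ (tensorAt k A)]
  ext I J
  simp only [tensorAt, tensorMatrix, Matrix.smul_apply, smul_eq_mul]
  rw [← Finset.mul_prod_erase Finset.univ
    (fun j => Function.update (1 : Fin n → Matrix (Fin 2) (Fin 2) ℂ) k ((-1 : ℂ) • A) j (I j) (J j))
    (Finset.mem_univ k), ← Finset.mul_prod_erase Finset.univ
    (fun j => Function.update (1 : Fin n → Matrix (Fin 2) (Fin 2) ℂ) k A j (I j) (J j))
    (Finset.mem_univ k), ← mul_assoc]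
  congr 1
  · simp
  · refine Finset.prod_congr rfl fun l hl => ?_
    rw [Function.update_of_ne (Finset.ne_of_mem_erase hl),
      Function.update_of_ne (Finset.ne_of_mem_erase hl)]

theorem tensorAt_matR_mul_circuitM {γ : Fin n → ℂˣ} {k : Fin n} (hk : (γ k : ℂ) = -1) :
    tensorAt k matR * (circuitM γ k : Matrix (Idx n) (Idx n) ℂ) =
      -((circuitM γ k : Matrix (Idx n) (Idx n) ℂ) * tensorAt k matR) := by
  change tensorAt k matR * tensorAt k (matG (γ k)) = -(tensorAt k (matG (γ k)) * tensorAt k matR)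
  rw [tensorAt_mul, tensorAt_mul, ← tensorAt_neg]
  congr 1
  ext i j
  fin_cases i <;> fin_cases j <;>
    simp [matR, matG, hk, Matrix.mul_apply, Fin.sum_univ_two] <;> norm_num

theorem tensorAt_matR_mul_circuitM_of_ne (γ : Fin n → ℂˣ) {k l : Fin n} (hkl : k ≠ l) :
    tensorAt k matR * (circuitM γ l : Matrix (Idx n) (Idx n) ℂ) =
      (circuitM γ l : Matrix (Idx n) (Idx n) ℂ) * tensorAt k matR :=
  tensorAt_comm hkl _ _

theorem tensorAt_matR_mulVec_root (k : Fin n) : tensorAt k matR *ᵥ root n = root n := by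
  ext I
  rw [tensorAt_mulVec, Fin.sum_univ_two]
  have h0 : Function.update I k 0 ≠ 1 := fun h => by simpa using congrFun h k
  rcases eq_zero_or_eq_one (I k) with h | h
  · have h1 : I ≠ 1 := by rintro rfl; simp at h
    simp [matR, root, h, h0, Pi.single_apply, h1]
  · have h1 : Function.update I k 1 = I := by rw [← h, Function.update_eq_self]
    simp [matR, root, h, h0, Pi.single_apply, h1]

theorem vecMul_tensorAt_matR (k : Fin n) (u : Idx n → ℂ) (J : Idx n) :
    (u ᵥ* tensorAt k matR) J =
      if J k = 0 then -u J + 2 * u (Function.update J k 1) else u J := by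
  have ht : (tensorAt k matR)ᵀ = tensorAt k matRᵀ := by
    ext I J
    simp only [tensorAt, tensorMatrix, transpose_apply]
    refine Finset.prod_congr rfl fun l _ => ?_
    by_cases h : l = k
    · subst h; simp
    · simp [h, Matrix.one_apply, eq_comm]
  rw [← mulVec_transpose, ht, tensorAt_mulVec, Fin.sum_univ_two]
  rcases eq_zero_or_eq_one (J k) with h | h
  · have h1 : Function.update J k 0 = J := by rw [← h, Function.update_eq_self]
    simp [matR, h, h1]
  · have h1 : Function.update J k 1 = J := by rw [← h, Function.update_eq_self]
    simp [matR, h, h1]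

theorem prod_sign_update_one {γ : Fin n → ℂˣ} {k : Fin n} (hk : (γ k : ℂ) = -1) (J : Idx n) :
    ∏ l, ((-1 : ℂ) ^ (Function.update J k 1 l : ℕ) *
      (γ l : ℂ) ^ (1 - (Function.update J k 1 l : ℕ))) =
    ∏ l, ((-1 : ℂ) ^ (J l : ℕ) * (γ l : ℂ) ^ (1 - (J l : ℕ))) := by
  refine Finset.prod_congr rfl fun l _ => ?_
  by_cases hl : l = k
  · subst hl
    rcases eq_zero_or_eq_one (J l) with h | h <;> simp [h, hk]
  · rw [Function.update_of_ne hl]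

theorem vecV_update_one {α β : ℂˣ} {γ : Fin n → ℂˣ} {k : Fin n} (hk : (γ k : ℂ) = -1) {J : Idx n}
    (h : J ≠ 0 ∨ (α : ℂ) + β = 0) : vecV α β γ (Function.update J k 1) = vecV α β γ J := by
  have h0 : Function.update J k 1 ≠ 0 := fun h => by simpa using congrFun h k
  rw [vecV_eq, vecV_eq, if_neg h0]
  have h1 : (if J = 0 then ((α : ℂ) + β) * ∏ k, (γ k : ℂ) else 0) = 0 := by
    rcases h with h | h
    · rw [if_neg h]
    · rw [h]; simp
  rw [h1, prod_sign_update_one hk]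

theorem skew_commute_inv {ι : Type*} [Fintype ι] [DecidableEq ι] {P : Matrix ι ι ℂ} {a : GL ι ℂ}
    {c : ℂ} (hc : c ≠ 0) (ha : P * (a : Matrix ι ι ℂ) = c • ((a : Matrix ι ι ℂ) * P)) :
    P * ((a⁻¹ : GL ι ℂ) : Matrix ι ι ℂ) = c⁻¹ • (((a⁻¹ : GL ι ℂ) : Matrix ι ι ℂ) * P) := by
  have h1 : (a : Matrix ι ι ℂ) * ((a⁻¹ : GL ι ℂ) : Matrix _ _ ℂ) = 1 := by
    rw [← Units.val_mul, mul_inv_cancel, Units.val_one]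
  have h2 : ((a⁻¹ : GL ι ℂ) : Matrix _ _ ℂ) * (a : Matrix ι ι ℂ) = 1 := by
    rw [← Units.val_mul, inv_mul_cancel, Units.val_one]
  rw [eq_inv_smul_iff₀ hc]
  calc c • (P * ((a⁻¹ : GL ι ℂ) : Matrix _ _ ℂ))
      = ((a⁻¹ : GL ι ℂ) : Matrix _ _ ℂ) * (c • ((a : Matrix ι ι ℂ) * P)) *
        ((a⁻¹ : GL ι ℂ) : Matrix _ _ ℂ) := by
        rw [mul_smul_comm, smul_mul_assoc, ← mul_assoc, h2, one_mul]
    _ = ((a⁻¹ : GL ι ℂ) : Matrix _ _ ℂ) * P := by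
        rw [← ha, mul_assoc, mul_assoc, h1, mul_one]

theorem vecV_ne_zero {α β : ℂˣ} {γ : Fin n → ℂˣ} (h : IrrCondition α β γ) : vecV α β γ ≠ 0 := by
  intro h0
  have h1 := vecV_dotProduct_jointEigvec α β γ 0
  have h2 : ∏ k, (γ k : ℂ) ^ (1 - ((0 : Idx n) k : ℕ)) ≠ 0 :=
    Finset.prod_ne_zero_iff.mpr fun k _ => pow_ne_zero _ (γ k).ne_zero
  have h3 := mul_ne_zero α.ne_zero β.ne_zero
  rw [h0, zero_dotProduct] at h1
  exact mul_ne_zero (mul_ne_zero (div_ne_zero (by simp) h3) h2)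
    (mul_ne_zero (h 0).1 (h 0).2) h1.symm

variable [NeZero n]

theorem conj_mem_ref {α β : ℂˣ} {γ : Fin n → ℂˣ} {g : GL (Idx n) ℂ} (hg : g ∈ Mon α β γ)
    {c : GL (Idx n) ℂ} (hc : c ∈ Ref α β γ) : g * c * g⁻¹ ∈ Ref α β γ := by
  induction hc using Subgroup.closure_induction with
  | mem c hc =>
    obtain ⟨h, hh, rfl⟩ := hc
    exact Subgroup.subset_closure ⟨g * h, mul_mem hg hh, by group⟩
  | one => simp [one_mem]
  | mul a b _ _ ha hb => simpa [mul_assoc] using mul_mem ha hb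
  | inv a _ ha => simpa [mul_assoc] using inv_mem ha

/-- If a matrix `P` fixes `e` and `v` and commutes with each `M_k` up to a scalar,
then it commutes with the conjugates of `M_0`, so that `ker (P - 1)` is `Ref`-invariant. It contains
`e`, but not `M_k e` if `P` anticommutes with `M_k`. -/
theorem not_actsIrreducibly_of_skew_commuting {α β : ℂˣ} {γ : Fin n → ℂˣ}
    (P : Matrix (Idx n) (Idx n) ℂ) (hroot : P *ᵥ root n = root n)
    (hv : vecV α β γ ᵥ* P = vecV α β γ)
    (hM : ∀ l, ∃ c : ℂ, c ≠ 0 ∧ P * (circuitM γ l : Matrix (Idx n) (Idx n) ℂ) =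
      c • ((circuitM γ l : Matrix (Idx n) (Idx n) ℂ) * P))
    (k : Fin n) (hk : P * (circuitM γ k : Matrix (Idx n) (Idx n) ℂ) =
      -((circuitM γ k : Matrix (Idx n) (Idx n) ℂ) * P)) :
    ¬ ActsIrreducibly (Ref α β γ : Set (GL (Idx n) ℂ)) := by
  intro hirr
  have h0 : P * (circuitM0 α β γ : Matrix (Idx n) (Idx n) ℂ) =
      (circuitM0 α β γ : Matrix (Idx n) (Idx n) ℂ) * P := by
    refine Matrix.mulVec_injective (funext fun w => ?_)
    rw [← mulVec_mulVec, ← mulVec_mulVec, circuitM0_mulVec, circuitM0_mulVec, mulVec_sub,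
      mulVec_smul, hroot, dotProduct_mulVec, hv]
  have hMon : ∀ g ∈ Mon α β γ, ∃ c : ℂ, c ≠ 0 ∧ P * (g : Matrix (Idx n) (Idx n) ℂ) =
      c • ((g : Matrix (Idx n) (Idx n) ℂ) * P) := by
    intro g hg
    induction hg using Subgroup.closure_induction with
    | mem g hg =>
      rcases hg with rfl | ⟨l, rfl⟩
      · exact ⟨1, one_ne_zero, by rw [one_smul, h0]⟩
      · exact hM l
    | one => exact ⟨1, one_ne_zero, by simp⟩
    | mul a b _ _ ha hb =>
      obtain ⟨c, hc, ha⟩ := ha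
      obtain ⟨d, hd, hb⟩ := hb
      refine ⟨c * d, mul_ne_zero hc hd, ?_⟩
      rw [Units.val_mul, ← mul_assoc, ha, smul_mul_assoc, mul_assoc, hb, mul_smul_comm, smul_smul,
        mul_assoc]
    | inv a _ ha =>
      obtain ⟨c, hc, ha⟩ := ha
      exact ⟨c⁻¹, inv_ne_zero hc, skew_commute_inv hc ha⟩
  have hst : Stable (Ref α β γ : Set (GL (Idx n) ℂ)) (LinearMap.ker (P - 1).mulVecLin) := by
    refine stable_closure ?_
    rintro _ ⟨g, hg, rfl⟩ w hw
    obtain ⟨c, hc, hPg⟩ := hMon g hg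
    have hcomm : P * ((g * circuitM0 α β γ * g⁻¹ : GL (Idx n) ℂ) : Matrix (Idx n) (Idx n) ℂ) =
        ((g * circuitM0 α β γ * g⁻¹ : GL (Idx n) ℂ) : Matrix (Idx n) (Idx n) ℂ) * P := by
      rw [Units.val_mul, Units.val_mul, ← mul_assoc, ← mul_assoc, hPg, smul_mul_assoc,
        smul_mul_assoc, mul_assoc _ P, h0, mul_assoc, mul_assoc, mul_assoc,
        skew_commute_inv hc hPg, mul_smul_comm, mul_smul_comm, smul_smul, mul_inv_cancel₀ hc,
        one_smul]
      simp only [mul_assoc]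
    rw [LinearMap.mem_ker, mulVecLin_apply, sub_mulVec, one_mulVec, sub_eq_zero] at hw ⊢
    rw [mulVec_mulVec, hcomm, ← mulVec_mulVec, hw]
  rcases hirr.2 _ hst with hbot | htop
  · have h1 : root n ∈ LinearMap.ker (P - 1).mulVecLin := by
      rw [LinearMap.mem_ker, mulVecLin_apply, sub_mulVec, one_mulVec, sub_eq_zero, hroot]
    rw [hbot, Submodule.mem_bot] at h1
    exact root_ne_zero h1
  · have h1 : (circuitM γ k : Matrix (Idx n) (Idx n) ℂ) *ᵥ root n ∈
        LinearMap.ker (P - 1).mulVecLin := htop ▸ Submodule.mem_top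
    rw [LinearMap.mem_ker, mulVecLin_apply, sub_mulVec, one_mulVec, sub_eq_zero, mulVec_mulVec, hk,
      neg_mulVec, ← mulVec_mulVec, hroot, neg_eq_self, mulVec_eq_zero_iff] at h1
    exact root_ne_zero h1

theorem atMostOneNegOne_of_actsIrreducibly {α β : ℂˣ} {γ : Fin n → ℂˣ}
    (h : ActsIrreducibly (Ref α β γ : Set (GL (Idx n) ℂ))) : AtMostOneNegOne α β γ := by
  have hone : ∀ k, (γ k : ℂ) = -1 → (α : ℂ) * (β : ℂ)⁻¹ = -1 → False := by
    intro k hk hαβ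
    have hsum : (α : ℂ) + β = 0 := by
      have := β.ne_zero
      field_simp at hαβ
      linear_combination hαβ
    refine not_actsIrreducibly_of_skew_commuting (tensorAt k matR) (tensorAt_matR_mulVec_root k)
      (funext fun J => ?_) (fun l => ?_) k (tensorAt_matR_mul_circuitM hk) h
    · rw [vecMul_tensorAt_matR, vecV_update_one hk (Or.inr hsum)]
      split_ifs <;> ring
    · by_cases hl : k = l
      · subst hl
        exact ⟨-1, by simp, by rw [tensorAt_matR_mul_circuitM hk, neg_one_smul]⟩
      · exact ⟨1, one_ne_zero, by rw [one_smul, tensorAt_matR_mul_circuitM_of_ne γ hl]⟩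
  have htwo : ∀ k l, (γ k : ℂ) = -1 → (γ l : ℂ) = -1 → k = l := by
    intro k l hk hl
    by_contra hkl
    have hk' : tensorAt k matR * tensorAt l matR * (circuitM γ k : Matrix (Idx n) (Idx n) ℂ) =
        -((circuitM γ k : Matrix (Idx n) (Idx n) ℂ) * (tensorAt k matR * tensorAt l matR)) := by
      rw [mul_assoc, tensorAt_matR_mul_circuitM_of_ne γ (Ne.symm hkl), ← mul_assoc,
        tensorAt_matR_mul_circuitM hk, neg_mul, mul_assoc]
    refine not_actsIrreducibly_of_skew_commuting (tensorAt k matR * tensorAt l matR)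
      ?_ (funext fun J => ?_) (fun j => ?_) k hk' h
    · rw [← mulVec_mulVec, tensorAt_matR_mulVec_root, tensorAt_matR_mulVec_root]
    · rw [← vecMul_vecMul, vecMul_tensorAt_matR, vecMul_tensorAt_matR, vecMul_tensorAt_matR,
        Function.update_of_ne hkl]
      rcases eq_zero_or_eq_one (J l) with hJl | hJl
      · rcases eq_zero_or_eq_one (J k) with hJk | hJk
        · have h1 : Function.update J l 1 ≠ 0 := fun h => by simpa using congrFun h l
          have h2 : Function.update J k 1 ≠ 0 := fun h => by simpa using congrFun h k
          have h3 : vecV α β γ (Function.update J l 1) = vecV α β γ (Function.update J k 1) := by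
            rw [← vecV_update_one hk (Or.inl h1), ← vecV_update_one hl (Or.inl h2),
              Function.update_comm hkl]
          rw [if_pos hJl, if_pos hJk, if_pos hJk, vecV_update_one hk (Or.inl h1), h3]
          ring
        · have h1 : J ≠ 0 := by rintro rfl; simp at hJk
          simp only [hJl, hJk, one_ne_zero, if_true, if_false]
          rw [vecV_update_one hl (Or.inl h1)]
          ring
      · rw [if_neg (by simp [hJl])]
        have h1 : J ≠ 0 := by rintro rfl; simp at hJl
        split_ifs
        · rw [vecV_update_one hk (Or.inl h1)]
          ring
        · rfl
    · by_cases hjk : k = j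
      · subst hjk
        exact ⟨-1, by simp, by rw [hk', neg_one_smul]⟩
      · by_cases hjl : l = j
        · subst hjl
          refine ⟨-1, by simp, ?_⟩
          rw [mul_assoc, tensorAt_matR_mul_circuitM hl, mul_neg, ← mul_assoc,
            tensorAt_matR_mul_circuitM_of_ne γ hkl, mul_assoc, neg_one_smul]
        · refine ⟨1, one_ne_zero, ?_⟩
          rw [mul_assoc, tensorAt_matR_mul_circuitM_of_ne γ hjl, ← mul_assoc,
            tensorAt_matR_mul_circuitM_of_ne γ hjk, mul_assoc, one_smul]
  rintro (_ | k) hk (_ | l) hl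
  · rfl
  · exact (hone l hl hk).elim
  · exact (hone k hk hl).elim
  · rw [htwo k l hk hl]

/-- A simple `Ref`-submodule contains the root of one of the reflections, so some translate `U` of it
contains `e`. For any `g ∈ Mon` that moves `U` the form `v` vanishes on `gU`, and for `g = M_k` the quadratic
equation of `M_k` forces `γ_k = -1`. If no `M_k` moves `U`, then `U` is everything; if exactly one
does, then `v` vanishes on `M_k e_J` for a suitable `J`, which says `α + β = 0`. -/
theorem actsIrreducibly_ref {α β : ℂˣ} {γ : Fin n → ℂˣ} (h : IrrCondition α β γ)
    (h1 : AtMostOneNegOne α β γ) : ActsIrreducibly (Ref α β γ : Set (GL (Idx n) ℂ)) := by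
  refine ⟨inferInstance, fun W hW => ?_⟩
  by_contra! hcon
  obtain ⟨hbot, htop⟩ := hcon
  obtain ⟨W₀, hW₀, hmin₀⟩ := exists_minStable_le hW hbot
  have hconj : ∀ g ∈ Mon α β γ, ∀ c ∈ (Ref α β γ : Set (GL (Idx n) ℂ)),
      g⁻¹ * c * g ∈ (Ref α β γ : Set (GL (Idx n) ℂ)) := fun g hg c hc => by
    simpa using conj_mem_ref (inv_mem hg) hc
  have hmin : ∀ g ∈ Mon α β γ, MinStable (Ref α β γ : Set (GL (Idx n) ℂ)) (translate g W₀) :=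
    fun g hg => hmin₀.translate (hconj g hg) fun c hc => conj_mem_ref hg hc
  obtain ⟨a, ha, w₀, hw₀, hv₀⟩ : ∃ a ∈ Mon α β γ, ∃ w ∈ W₀,
      vecV α β γ ⬝ᵥ ((a : Matrix (Idx n) (Idx n) ℂ) *ᵥ w) ≠ 0 := by
    by_contra! hz
    let K : Submodule ℂ (Idx n → ℂ) :=
      { carrier := {w | ∀ a ∈ Mon α β γ, vecV α β γ ⬝ᵥ ((a : Matrix (Idx n) (Idx n) ℂ) *ᵥ w) = 0}
        add_mem' := fun hx hy a ha => by
          rw [mulVec_add, dotProduct_add, hx a ha, hy a ha, add_zero]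
        zero_mem' := fun a _ => by rw [mulVec_zero, dotProduct_zero]
        smul_mem' := fun c x hx a ha => by rw [mulVec_smul, dotProduct_smul, hx a ha, smul_zero] }
    have hK : Stable (Mon α β γ : Set (GL (Idx n) ℂ)) K := fun g hg w hw a ha => by
      rw [← coe_mulVec_mul]
      exact hw _ (mul_mem ha hg)
    rcases (actsIrreducibly_mon h).2 K hK with h0 | h0
    · obtain ⟨w, hw, hw0⟩ := W₀.ne_bot_iff.mp hmin₀.1
      have : w ∈ K := fun a ha => hz a ha w hw
      rw [h0, Submodule.mem_bot] at this
      exact hw0 this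
    · refine vecV_ne_zero h (funext fun J => ?_)
      have : (Pi.single J 1 : Idx n → ℂ) ∈ K := h0 ▸ Submodule.mem_top
      have h2 := this 1 (one_mem _)
      rwa [Units.val_one, one_mulVec, dotProduct_single, mul_one] at h2
  set U := translate a W₀ with hU
  have hUmin := hmin a ha
  set u := (a : Matrix (Idx n) (Idx n) ℂ) *ᵥ w₀ with hu
  have huU : u ∈ U := mulVec_mem_translate.mpr hw₀
  have hUtop : U ≠ ⊤ := by
    intro h
    have h2 : translate a⁻¹ U = W₀ := by rw [hU, ← translate_mul, inv_mul_cancel, translate_one]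
    rw [h] at h2
    exact htop (top_le_iff.mp (h2 ▸ hW₀ : translate a⁻¹ ⊤ ≤ W))
  have hroot : root n ∈ U := by
    have := mulVec_root_mem (α := α) (β := β) (γ := γ) (g := 1) huU
      (hUmin.2.1 _ (Subgroup.subset_closure ⟨1, one_mem _, rfl⟩) u huU)
      (by simpa using hv₀)
    simpa using this
  have hA : ∀ g ∈ Mon α β γ, translate g U = U ∨
      ∀ w ∈ U, vecV α β γ ⬝ᵥ ((g : Matrix (Idx n) (Idx n) ℂ) *ᵥ w) = 0 := by
    intro g hg
    refine or_iff_not_imp_right.mpr fun hne => ?_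
    push Not at hne
    obtain ⟨w, hw, hvw⟩ := hne
    have h2 := mulVec_root_mem (α := α) (β := β) (γ := γ) (g := g⁻¹) hw
      (hUmin.2.1 _ (Subgroup.subset_closure ⟨g⁻¹, inv_mem hg, rfl⟩) w hw) (by simpa using hvw)
    exact (hUmin.translate (hconj g hg) fun c hc => conj_mem_ref hg hc).eq_of_mem hUmin
      root_ne_zero (mem_translate.mpr h2) hroot
  have hB : ∀ k, translate (circuitM γ k) U = U ∨ (γ k : ℂ) = -1 := by
    intro k
    refine or_iff_not_imp_left.mpr fun hne => ?_
    have hk := circuitM_mem_mon α β γ k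
    have hγ := (γ k).ne_zero
    have hv1 := (hA _ hk).resolve_left hne
    have hsq : translate (circuitM γ k * circuitM γ k) U = U := by
      refine (hA _ (mul_mem hk hk)).resolve_right fun hz => hv₀ ?_
      have h2 := hz u huU
      rw [coe_mulVec_mul, circuitM_quadratic, dotProduct_sub, dotProduct_smul, hv1 u huU,
        smul_zero, zero_sub, neg_eq_zero, dotProduct_smul, smul_eq_mul] at h2
      exact (mul_eq_zero.mp h2).resolve_left (inv_ne_zero hγ)
    by_contra hne1
    have hne2 : 1 + (γ k : ℂ)⁻¹ ≠ 0 := by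
      intro h0
      field_simp at h0
      exact hne1 (by linear_combination h0)
    have hu0 : u ≠ 0 := fun h0 => hv₀ (by rw [h0, dotProduct_zero])
    have hm : (circuitM γ k : Matrix (Idx n) (Idx n) ℂ) *ᵥ u ∈ U := by
      have h2 : ((circuitM γ k * circuitM γ k : GL (Idx n) ℂ) : Matrix (Idx n) (Idx n) ℂ) *ᵥ u ∈
          U := by
        have := mulVec_mem_translate (g := circuitM γ k * circuitM γ k).mpr huU
        rwa [hsq] at this
      rw [coe_mulVec_mul, circuitM_quadratic] at h2
      have h3 := U.add_mem h2 (U.smul_mem (γ k : ℂ)⁻¹ huU)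
      rw [sub_add_cancel] at h3
      exact (U.smul_mem_iff hne2).mp h3
    exact hne ((hUmin.translate (hconj _ hk) fun c hc => conj_mem_ref hk hc).eq_of_mem hUmin
      (fun h0 => hu0 ((mulVec_eq_zero_iff _).mp h0)) (mulVec_mem_translate.mpr huU) hm)
  have hstab : ∀ k, translate (circuitM γ k) U = U → ∀ w ∈ U,
      (circuitM γ k : Matrix (Idx n) (Idx n) ℂ) *ᵥ w ∈ U := by
    intro k hk w hw
    have := mulVec_mem_translate (g := circuitM γ k).mpr hw
    rwa [hk] at this
  obtain ⟨k, hk⟩ : ∃ k, translate (circuitM γ k) U ≠ U := by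
    by_contra! hall
    exact hUtop (eq_top_of_root_mem γ (fun k => hstab k (hall k)) hroot)
  have hγk := (hB k).resolve_left hk
  have hoth : ∀ l ∈ Finset.univ.erase k, ∀ w ∈ U,
      (circuitM γ l : Matrix (Idx n) (Idx n) ℂ) *ᵥ w ∈ U := by
    intro l hl
    refine hstab l ((hB l).resolve_right fun hγl => ?_)
    have := @h1 (some l) hγl (some k) hγk
    exact Finset.ne_of_mem_erase hl (Option.some.inj this)
  have hJ := single_mem_of_root_mem γ (Finset.univ.erase k) hoth hroot
    (Function.update 0 k 1) (fun l hl => by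
      have : l = k := by simpa using hl
      subst this
      simp)
  have hv := ((hA _ (circuitM_mem_mon α β γ k)).resolve_left hk) _ hJ
  have heq := single_update_zero_eq γ (k := k) (J := Function.update 0 k 1) (by simp)
  have hupd : Function.update (Function.update (0 : Idx n) k 1) k 0 = 0 := by
    rw [Function.update_idem]
    exact Function.update_eq_self k 0
  have hvv := congrArg (fun x => vecV α β γ ⬝ᵥ x) heq
  simp only [dotProduct_sub, dotProduct_smul, hv, smul_zero, sub_zero, hupd, dotProduct_single,
    mul_one] at hvv
  have h01 : Function.update (0 : Idx n) k 1 ≠ 0 := fun h => by simpa using congrFun h k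
  have hγ : ∏ k, (γ k : ℂ) ≠ 0 := Finset.prod_ne_zero_iff.mpr fun k _ => (γ k).ne_zero
  have hsum : (α : ℂ) + β = 0 := by
    by_contra hne
    rw [vecV_eq, vecV_eq, if_pos rfl, if_neg h01, prod_sign_update_one hγk] at hvv
    have hc : (-1 : ℂ) ^ n / ((α : ℂ) * β) ≠ 0 :=
      div_ne_zero (by simp) (mul_ne_zero α.ne_zero β.ne_zero)
    have h2 := mul_left_cancel₀ hc hvv
    exact mul_ne_zero hne hγ (by linear_combination -h2)
  have hαβ : (α : ℂ) * (β : ℂ)⁻¹ = -1 := by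
    rw [eq_neg_of_add_eq_zero_left hsum, neg_mul, mul_inv_cancel₀ β.ne_zero]
  simpa using @h1 none hαβ (some k) hγk

end ReflectionSubgroup

/-! ### Weight spaces of a normal subgroup -/

/-- Among the combinations of two independent vectors there is a nonzero one in the kernel of a
given linear form. -/
theorem exists_mem_dotProduct_eq_zero {ι : Type*} [Fintype ι] {W : Submodule ℂ (ι → ℂ)} {x y : ι → ℂ}
    (hx : x ∈ W) (hy : y ∈ W) (hx0 : x ≠ 0) (hxy : ∀ c : ℂ, y ≠ c • x) (v : ι → ℂ) :
    ∃ z ∈ W, z ≠ 0 ∧ v ⬝ᵥ z = 0 := by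
  by_cases h : v ⬝ᵥ x = 0
  · exact ⟨x, hx, hx0, h⟩
  · refine ⟨y - (v ⬝ᵥ y / v ⬝ᵥ x) • x, W.sub_mem hy (W.smul_mem _ hx),
      sub_ne_zero.mpr (hxy _), ?_⟩
    rw [dotProduct_sub, dotProduct_smul, smul_eq_mul, div_mul_cancel₀ _ h, sub_self]

section Weights

variable {ι : Type*} [Fintype ι] [DecidableEq ι]

/-- The space of simultaneous eigenvectors of `C` on which `c ∈ C` acts by the scalar `χ c`. -/
def weightSpace (C : Subgroup (GL ι ℂ)) (χ : C → ℂ) : Submodule ℂ (ι → ℂ) where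
  carrier := {w | ∀ c : C, ((c : GL ι ℂ) : Matrix ι ι ℂ) *ᵥ w = χ c • w}
  add_mem' := fun hx hy c => by rw [mulVec_add, hx c, hy c, smul_add]
  zero_mem' := fun c => by rw [mulVec_zero, smul_zero]
  smul_mem' := fun a x hx c => by rw [mulVec_smul, hx c, smul_comm]

theorem mem_weightSpace {C : Subgroup (GL ι ℂ)} {χ : C → ℂ} {w : ι → ℂ} :
    w ∈ weightSpace C χ ↔ ∀ c : C, ((c : GL ι ℂ) : Matrix ι ι ℂ) *ᵥ w = χ c • w := Iff.rfl

theorem iSupIndep_weightSpace (C : Subgroup (GL ι ℂ)) : iSupIndep (weightSpace C) := by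
  classical
  rw [iSupIndep_iff_finsetSum_eq_zero_imp_eq_zero]
  intro s
  induction s using Finset.induction_on with
  | empty => simp
  | insert χ s hχ ih =>
    intro u hu hsum
    rw [Finset.sum_insert hχ] at hsum
    -- Applying `c - χ c` removes the term of weight `χ`.
    have h1 : ∀ c : C, ∀ ψ ∈ s, (ψ c - χ c) • u ψ = 0 := by
      intro c
      refine ih (fun ψ => (ψ c - χ c) • u ψ)
        (fun ψ hψ => Submodule.smul_mem _ _ (hu ψ (Finset.mem_insert_of_mem hψ))) ?_
      have h2 := congrArg (fun x => ((c : GL ι ℂ) : Matrix ι ι ℂ) *ᵥ x - χ c • x) hsum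
      simp only [mulVec_add, mulVec_zero, smul_zero, sub_zero, smul_add,
        mem_weightSpace.mp (hu χ (Finset.mem_insert_self _ _)) c, mulVec_sum,
        Finset.smul_sum] at h2
      rw [add_sub_add_left_eq_sub, ← Finset.sum_sub_distrib] at h2
      rw [← h2]
      refine Finset.sum_congr rfl fun ψ hψ => ?_
      rw [mem_weightSpace.mp (hu ψ (Finset.mem_insert_of_mem hψ)) c, sub_smul]
    have h3 : ∀ ψ ∈ s, u ψ = 0 := by
      intro ψ hψ
      obtain ⟨c, hc⟩ := Function.ne_iff.mp (ne_of_mem_of_not_mem hψ hχ)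
      exact (smul_eq_zero.mp (h1 c ψ hψ)).resolve_left (sub_ne_zero.mpr hc)
    intro ψ hψ
    rcases Finset.mem_insert.mp hψ with rfl | hψ
    · rwa [Finset.sum_eq_zero h3, add_zero] at hsum
    · exact h3 ψ hψ

/-- The sum of the weight spaces of weight different from `χ`. -/
def otherWeights (C : Subgroup (GL ι ℂ)) (χ : C → ℂ) : Submodule ℂ (ι → ℂ) :=
  ⨆ ψ, ⨆ _ : ψ ≠ χ, weightSpace C ψ

theorem mem_otherWeights {C : Subgroup (GL ι ℂ)} {χ ψ : C → ℂ} (h : ψ ≠ χ) {w : ι → ℂ}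
    (hw : w ∈ weightSpace C ψ) : w ∈ otherWeights C χ :=
  Submodule.mem_iSup_of_mem ψ (Submodule.mem_iSup_of_mem h hw)

theorem eq_zero_of_mem_otherWeights {C : Subgroup (GL ι ℂ)} {χ : C → ℂ} {w : ι → ℂ}
    (hw : w ∈ weightSpace C χ) (hw' : w ∈ otherWeights C χ) : w = 0 :=
  Submodule.disjoint_def.mp (iSupIndep_weightSpace C χ) w hw hw'

theorem weight_eq {C : Subgroup (GL ι ℂ)} {χ ψ : C → ℂ} {w : ι → ℂ} (h0 : w ≠ 0)
    (hw : w ∈ weightSpace C χ) (hw' : w ∈ weightSpace C ψ) : ψ = χ := by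
  by_contra hne
  exact h0 (eq_zero_of_mem_otherWeights hw (mem_otherWeights hne hw'))

/-- A matrix normalizing `C` permutes the weight spaces. -/
theorem exists_translate_weightSpace {C : Subgroup (GL ι ℂ)} {g : GL ι ℂ}
    (hg : ∀ c ∈ C, g⁻¹ * c * g ∈ C) (hg' : ∀ c ∈ C, g * c * g⁻¹ ∈ C) (χ : C → ℂ) :
    ∃ ψ : C → ℂ, translate g (weightSpace C χ) = weightSpace C ψ := by
  refine ⟨fun c => χ ⟨g⁻¹ * c * g, hg c c.2⟩, ?_⟩
  ext w
  rw [mem_translate, mem_weightSpace, mem_weightSpace]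
  constructor
  · intro h c
    have h1 := h ⟨g⁻¹ * c * g, hg c c.2⟩
    rw [coe_mulVec_mul, coe_mulVec_mul, mulVec_inv_mulVec] at h1
    have h2 := congrArg (fun x => (g : Matrix ι ι ℂ) *ᵥ x) h1
    simpa only [mulVec_inv_mulVec, mulVec_smul] using h2
  · intro h c
    have h1 := h ⟨g * c * g⁻¹, hg' c c.2⟩
    have h2 := congrArg (fun x => ((g⁻¹ : GL ι ℂ) : Matrix ι ι ℂ) *ᵥ x) h1
    simp only [coe_mulVec_mul, inv_mulVec_mulVec, mulVec_smul] at h2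
    rw [h2]
    congr 2
    ext1
    simp [mul_assoc]

/-- If `g` satisfies a quadratic equation `(g - 1)(g - q) = 0` on a weight vector `x` and moves `x` to
another weight space, then `q = -1`: otherwise `x`, `g x`, `g² x` would be weight vectors with a
relation that their weights forbid. -/
theorem eq_neg_one_of_weight_ne {C : Subgroup (GL ι ℂ)} {χ χ₁ χ₂ : C → ℂ} {x : ι → ℂ}
    {g : GL ι ℂ} {q : ℂ} (hq : q ≠ 0) (h0 : x ≠ 0) (hx : x ∈ weightSpace C χ)
    (hx1 : (g : Matrix ι ι ℂ) *ᵥ x ∈ weightSpace C χ₁)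
    (hx2 : (g : Matrix ι ι ℂ) *ᵥ ((g : Matrix ι ι ℂ) *ᵥ x) ∈ weightSpace C χ₂)
    (hg : (g : Matrix ι ι ℂ) *ᵥ ((g : Matrix ι ι ℂ) *ᵥ x) =
      (1 + q) • ((g : Matrix ι ι ℂ) *ᵥ x) - q • x) (hne : χ₁ ≠ χ) : q = -1 := by
  have h2 : χ₂ = χ := by
    by_contra hne2
    have h1 : q • x = (1 + q) • ((g : Matrix ι ι ℂ) *ᵥ x) -
        (g : Matrix ι ι ℂ) *ᵥ ((g : Matrix ι ι ℂ) *ᵥ x) := by rw [hg, sub_sub_cancel]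
    have h3 : q • x ∈ otherWeights C χ := by
      rw [h1]
      exact Submodule.sub_mem _ (Submodule.smul_mem _ _ (mem_otherWeights hne hx1))
        (mem_otherWeights hne2 hx2)
    rcases smul_eq_zero.mp (eq_zero_of_mem_otherWeights (Submodule.smul_mem _ q hx) h3) with h | h
    · exact hq h
    · exact h0 h
  subst h2
  have h1 : (1 + q) • ((g : Matrix ι ι ℂ) *ᵥ x) ∈ weightSpace C χ₂ := by
    have := Submodule.add_mem _ hx2 (Submodule.smul_mem _ q hx)
    rwa [hg, sub_add_cancel] at this
  have h3 := eq_zero_of_mem_otherWeights h1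
    (Submodule.smul_mem _ _ (mem_otherWeights hne hx1))
  rcases smul_eq_zero.mp h3 with h | h
  · linear_combination h
  · exact (h0 ((mulVec_eq_zero_iff g).mp h)).elim

end Weights

/-! ### Weight spaces of dimension at least two -/

section Component

variable {n : ℕ} [NeZero n]

theorem single_zero_ne_smul_root (c : ℂ) : (Pi.single 0 1 : Idx n → ℂ) ≠ c • root n := by
  intro h
  have := congrFun h 0
  simp [root, Pi.single_eq_of_ne (one_ne_zero_idx (n := n)).symm] at this

/-- If a subgroup of finite index of `Mon` consists of scalar matrices, then `Mon` is finite: each of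
the generators fixes a nonzero vector, so it has finite order as soon as a power of it is scalar; then
the determinants of the elements of `Mon` are roots of unity of bounded order, and so are the
scalars. -/
theorem finite_mon_of_scalar {α β : ℂˣ} {γ : Fin n → ℂˣ} {C : Subgroup (GL (Idx n) ℂ)}
    (hle : C ≤ Mon α β γ) (hidx : C.relIndex (Mon α β γ) ≠ 0) {χ : C → ℂ}
    (hχ : weightSpace C χ = ⊤) : Finite (Mon α β γ) := by
  have hscal : ∀ c : C, ∀ w, ((c : GL (Idx n) ℂ) : Matrix (Idx n) (Idx n) ℂ) *ᵥ w = χ c • w :=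
    fun c w => mem_weightSpace.mp (hχ ▸ Submodule.mem_top : w ∈ weightSpace C χ) c
  have hone : ∀ c : C, (∃ w : Idx n → ℂ, w ≠ 0 ∧
      ((c : GL (Idx n) ℂ) : Matrix (Idx n) (Idx n) ℂ) *ᵥ w = w) → (c : GL (Idx n) ℂ) = 1 := by
    rintro c ⟨w, hw0, hw⟩
    have h1 : χ c = 1 := by
      have h2 := hscal c w
      rw [hw] at h2
      have h3 : (χ c - 1) • w = 0 := by rw [sub_smul, one_smul, ← h2, sub_self]
      exact sub_eq_zero.mp ((smul_eq_zero.mp h3).resolve_right hw0)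
    ext1
    refine Matrix.mulVec_injective (funext fun w => ?_)
    rw [hscal, h1, one_smul, Units.val_one, one_mulVec]
  set m := (C.relIndex (Mon α β γ)).factorial with hm
  have hpow : ∀ g ∈ Mon α β γ, g ^ m ∈ C := by
    intro g hg
    obtain ⟨r, hr0, hr, hgr⟩ := Subgroup.exists_pow_mem_of_relIndex_ne_zero hidx hg
    obtain ⟨s, hs⟩ := Nat.dvd_factorial hr0 hr
    rw [hm, hs, pow_mul]
    exact pow_mem hgr.1 s
  have hfix : ∀ g ∈ Mon α β γ, (∃ w : Idx n → ℂ, w ≠ 0 ∧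
      (g : Matrix (Idx n) (Idx n) ℂ) *ᵥ w = w) → g ^ m = 1 := by
    rintro g hg ⟨w, hw0, hw⟩
    refine hone ⟨g ^ m, hpow g hg⟩ ⟨w, hw0, ?_⟩
    have : ∀ r : ℕ, ((g ^ r : GL (Idx n) ℂ) : Matrix (Idx n) (Idx n) ℂ) *ᵥ w = w := by
      intro r
      induction r with
      | zero => rw [pow_zero, Units.val_one, one_mulVec]
      | succ r ih => rw [pow_succ, coe_mulVec_mul, hw, ih]
    exact this m
  have hdet : ∀ g ∈ Mon α β γ, (g : Matrix (Idx n) (Idx n) ℂ).det ^ m = 1 := by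
    intro g hg
    have key : Matrix.GeneralLinearGroup.det g ^ m = 1 := by
      induction hg using Subgroup.closure_induction with
      | mem g hg =>
        rw [← map_pow, hfix g (Subgroup.subset_closure hg), map_one]
        rcases hg with rfl | ⟨k, rfl⟩
        · obtain ⟨z, -, hz0, hz⟩ := exists_mem_dotProduct_eq_zero (W := ⊤) (x := root n)
            (y := Pi.single 0 1) trivial trivial root_ne_zero single_zero_ne_smul_root
            (vecV α β γ)
          exact ⟨z, hz0, by rw [circuitM0_mulVec, hz, zero_smul, sub_zero]⟩
        · refine ⟨jointEigvec γ 0, fun h => ?_, ?_⟩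
          · simpa [jointEigvec_zero] using congrFun h 0
          · rw [circuitM_mulVec_jointEigvec, Pi.zero_apply, if_pos rfl, one_smul]
      | one => rw [map_one, one_pow]
      | mul a b _ _ ha hb => rw [map_mul, mul_pow, ha, hb, one_mul]
      | inv a _ ha => rw [map_inv, inv_pow, ha, inv_one]
    simpa using congrArg Units.val key
  have hmpos : 0 < Fintype.card (Idx n) * m :=
    Nat.mul_pos Fintype.card_pos (Nat.factorial_pos _)
  have hχpow : ∀ c : C, χ c ^ (Fintype.card (Idx n) * m) = 1 := by
    intro c
    have h1 : ((c : GL (Idx n) ℂ) : Matrix (Idx n) (Idx n) ℂ) = χ c • 1 := by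
      refine Matrix.mulVec_injective (funext fun w => ?_)
      rw [hscal, smul_mulVec, one_mulVec]
    have h2 := hdet c (hle c.2)
    rwa [h1, det_smul, det_one, mul_one, ← pow_mul] at h2
  have hCfin : Finite C := by
    have hroots : Set.Finite {z : ℂ | z ^ (Fintype.card (Idx n) * m) = 1} := by
      have := (Polynomial.nthRootsFinset (Fintype.card (Idx n) * m) (1 : ℂ)).finite_toSet
      refine this.subset fun z hz => ?_
      exact (Polynomial.mem_nthRootsFinset hmpos (1 : ℂ)).mpr hz
    have := hroots.to_subtype
    refine Finite.of_injective
      (fun c => (⟨χ c, hχpow c⟩ : {z : ℂ | z ^ (Fintype.card (Idx n) * m) = 1})) ?_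
    intro c d hcd
    have h1 : χ c = χ d := congrArg Subtype.val hcd
    ext1
    ext1
    refine Matrix.mulVec_injective (funext fun w => ?_)
    rw [hscal, hscal, h1]
  have hsub : Finite (C.subgroupOf (Mon α β γ)) :=
    Finite.of_injective (Subgroup.subgroupOfEquivOfLe hle) (MulEquiv.injective _)
  refine Nat.finite_of_card_ne_zero ?_
  rw [← (C.subgroupOf (Mon α β γ)).card_mul_index]
  exact mul_ne_zero Nat.card_pos.ne' hidx

/-- If some weight space of the normal subgroup `C` has dimension at least two, then it meets every
reflecting hyperplane nontrivially, so no reflection can move it. -/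
theorem weightSpace_eq_top {α β : ℂˣ} {γ : Fin n → ℂˣ} {C : Subgroup (GL (Idx n) ℂ)}
    (hnorm : ∀ g ∈ Mon α β γ, ∀ c ∈ C, g * c * g⁻¹ ∈ C)
    (hirr : ActsIrreducibly (Ref α β γ : Set (GL (Idx n) ℂ))) {χ : C → ℂ} {x y : Idx n → ℂ}
    (hx : x ∈ weightSpace C χ) (hy : y ∈ weightSpace C χ) (hx0 : x ≠ 0)
    (hxy : ∀ c : ℂ, y ≠ c • x) : weightSpace C χ = ⊤ := by
  have hnorm' : ∀ g ∈ Mon α β γ, ∀ c ∈ C, g⁻¹ * c * g ∈ C := fun g hg c hc => by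
    simpa using hnorm g⁻¹ (inv_mem hg) c hc
  have hst : Stable (Ref α β γ : Set (GL (Idx n) ℂ)) (weightSpace C χ) := by
    refine stable_closure ?_
    rintro _ ⟨g, hg, rfl⟩ w hw
    have hgi := inv_mem hg
    obtain ⟨ψ, hψ⟩ := exists_translate_weightSpace (hnorm' _ hgi) (hnorm _ hgi) χ
    obtain ⟨φ, hφ⟩ := exists_translate_weightSpace (hnorm' _ (circuitM0_mem_mon α β γ))
      (hnorm _ (circuitM0_mem_mon α β γ)) ψ
    obtain ⟨z, hz, hz0, hvz⟩ := exists_mem_dotProduct_eq_zero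
      (mulVec_mem_of_translate_eq hψ hx) (mulVec_mem_of_translate_eq hψ hy)
      (fun h => hx0 ((mulVec_eq_zero_iff _).mp h)) (fun c h => hxy c (by
        have := congrArg (fun u => (g : Matrix (Idx n) (Idx n) ℂ) *ᵥ u) h
        simpa only [mulVec_inv_mulVec, mulVec_smul] using this)) (vecV α β γ)
    have hz' : z ∈ weightSpace C φ := by
      have := mulVec_mem_of_translate_eq hφ hz
      rwa [circuitM0_mulVec, hvz, zero_smul, sub_zero] at this
    have hφψ := weight_eq hz0 hz hz'
    subst hφψ
    have h1 := mulVec_mem_of_translate_eq hφ (mulVec_mem_of_translate_eq hψ hw)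
    rw [coe_mulVec_mul, coe_mulVec_mul]
    exact mulVec_mem_of_translate_eq (by simpa using translate_inv_eq hψ) h1
  refine (hirr.2 _ hst).resolve_left fun h => hx0 ?_
  rwa [h, Submodule.mem_bot] at hx

end Component

/-! ### The monomial case -/

section Monomial

variable {n : ℕ}

theorem span_triple_ne_top (h : 4 ≤ 2 ^ n) (a b c : Idx n → ℂ) :
    Submodule.span ℂ ({a, b, c} : Set (Idx n → ℂ)) ≠ ⊤ := by
  classical
  intro htop
  have h1 := finrank_span_finset_le_card (R := ℂ) ({a, b, c} : Finset (Idx n → ℂ))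
  have h2 : Set.finrank ℂ (({a, b, c} : Finset (Idx n → ℂ)) : Set (Idx n → ℂ)) = 2 ^ n := by
    have h3 : (({a, b, c} : Finset (Idx n → ℂ)) : Set (Idx n → ℂ)) = {a, b, c} := by simp
    rw [Set.finrank, h3, htop, finrank_top, Module.finrank_fintype_fun_eq_card]
    simp
  have h4 : ({a, b, c} : Finset (Idx n → ℂ)).card ≤ 3 := Finset.card_le_three
  omega

variable [NeZero n]

theorem circuitM0_quadratic (α β : ℂˣ) (γ : Fin n → ℂˣ) (w : Idx n → ℂ) :
    (circuitM0 α β γ : Matrix (Idx n) (Idx n) ℂ) *ᵥ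
      ((circuitM0 α β γ : Matrix (Idx n) (Idx n) ℂ) *ᵥ w) =
      (1 + delta0 α β γ) • ((circuitM0 α β γ : Matrix (Idx n) (Idx n) ℂ) *ᵥ w) -
        delta0 α β γ • w := by
  simp only [circuitM0_mulVec, dotProduct_sub, dotProduct_smul, vecV_dotProduct_root, smul_eq_mul]
  module

theorem four_le_two_pow (h : n ≠ 1) : 4 ≤ 2 ^ n := by
  have : 2 ≤ n := by have := NeZero.ne n; omega
  calc 4 = 2 ^ 2 := rfl
    _ ≤ 2 ^ n := Nat.pow_le_pow_right (by norm_num) this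

/-- A monomial configuration: all weight spaces of the normal subgroup `C` are at most
one-dimensional, and `M_0` moves the weight vector `ℓ` to a weight vector of another weight. -/
structure MonomialData (α β : ℂˣ) (γ : Fin n → ℂˣ) (C : Subgroup (GL (Idx n) ℂ))
    (χ χ' : C → ℂ) (ℓ : Idx n → ℂ) : Prop where
  norm : ∀ g ∈ Mon α β γ, ∀ c ∈ C, g * c * g⁻¹ ∈ C
  mult_one : ∀ (ψ : C → ℂ) (x y : Idx n → ℂ), x ∈ weightSpace C ψ → y ∈ weightSpace C ψ → x ≠ 0 →
    ∃ c : ℂ, y = c • x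
  mem : ℓ ∈ weightSpace C χ
  mem' : (circuitM0 α β γ : Matrix (Idx n) (Idx n) ℂ) *ᵥ ℓ ∈ weightSpace C χ'
  weight_ne : χ' ≠ χ
  dot_ne : vecV α β γ ⬝ᵥ ℓ ≠ 0

namespace MonomialData

variable {α β : ℂˣ} {γ : Fin n → ℂˣ} {C : Subgroup (GL (Idx n) ℂ)} {χ χ' : C → ℂ} {ℓ : Idx n → ℂ}

theorem ne_zero (D : MonomialData α β γ C χ χ' ℓ) : ℓ ≠ 0 := fun h =>
  D.dot_ne (by rw [h, dotProduct_zero])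

theorem exists_weight (D : MonomialData α β γ C χ χ' ℓ) {g : GL (Idx n) ℂ} (hg : g ∈ Mon α β γ)
    {ψ : C → ℂ} {x : Idx n → ℂ} (hx : x ∈ weightSpace C ψ) :
    ∃ φ, (g : Matrix (Idx n) (Idx n) ℂ) *ᵥ x ∈ weightSpace C φ := by
  obtain ⟨φ, hφ⟩ := exists_translate_weightSpace
    (fun c hc => by simpa using D.norm g⁻¹ (inv_mem hg) c hc) (D.norm g hg) ψ
  exact ⟨φ, mulVec_mem_of_translate_eq hφ hx⟩

/-- The plane spanned by `ℓ` and `M_0 ℓ`. -/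
def plane (α β : ℂˣ) (γ : Fin n → ℂˣ) (ℓ : Idx n → ℂ) : Submodule ℂ (Idx n → ℂ) :=
  Submodule.span ℂ {ℓ, (circuitM0 α β γ : Matrix (Idx n) (Idx n) ℂ) *ᵥ ℓ}

theorem left_mem_plane : ℓ ∈ plane α β γ ℓ := Submodule.subset_span (by simp)

theorem right_mem_plane : (circuitM0 α β γ : Matrix (Idx n) (Idx n) ℂ) *ᵥ ℓ ∈ plane α β γ ℓ :=
  Submodule.subset_span (by simp)

theorem plane_induction {W : Submodule ℂ (Idx n → ℂ)} {g : GL (Idx n) ℂ}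
    (h1 : (g : Matrix (Idx n) (Idx n) ℂ) *ᵥ ℓ ∈ W)
    (h2 : (g : Matrix (Idx n) (Idx n) ℂ) *ᵥ
      ((circuitM0 α β γ : Matrix (Idx n) (Idx n) ℂ) *ᵥ ℓ) ∈ W) :
    ∀ w ∈ plane α β γ ℓ, (g : Matrix (Idx n) (Idx n) ℂ) *ᵥ w ∈ W := by
  intro w hw
  obtain ⟨a, b, rfl⟩ := Submodule.mem_span_pair.mp hw
  rw [mulVec_add, mulVec_smul, mulVec_smul]
  exact W.add_mem (W.smul_mem _ h1) (W.smul_mem _ h2)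

theorem root_mem_plane (D : MonomialData α β γ C χ χ' ℓ) : root n ∈ plane α β γ ℓ := by
  have h := Submodule.sub_mem _ (left_mem_plane (α := α) (β := β) (γ := γ) (ℓ := ℓ))
    right_mem_plane
  rw [circuitM0_mulVec, sub_sub_cancel] at h
  exact (Submodule.smul_mem_iff _ D.dot_ne).mp h

theorem circuitM0_mulVec_mem_plane (D : MonomialData α β γ C χ χ' ℓ) :
    ∀ w ∈ plane α β γ ℓ, (circuitM0 α β γ : Matrix (Idx n) (Idx n) ℂ) *ᵥ w ∈ plane α β γ ℓ := by
  intro w hw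
  rw [circuitM0_mulVec]
  exact Submodule.sub_mem _ hw (Submodule.smul_mem _ _ D.root_mem_plane)

/-- The reflection fixes all weight vectors outside the two lines that it interchanges. -/
theorem dot_eq_zero (D : MonomialData α β γ C χ χ' ℓ) {ψ : C → ℂ} {x : Idx n → ℂ}
    (hx : x ∈ weightSpace C ψ) (h1 : ψ ≠ χ) (h2 : ψ ≠ χ') : vecV α β γ ⬝ᵥ x = 0 := by
  obtain ⟨φ, hφ⟩ := D.exists_weight (circuitM0_mem_mon α β γ) hx
  -- Eliminating `e` gives a linear relation between four weight vectors.
  have hrel : (vecV α β γ ⬝ᵥ ℓ) • x -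
      (vecV α β γ ⬝ᵥ ℓ) • ((circuitM0 α β γ : Matrix (Idx n) (Idx n) ℂ) *ᵥ x) =
      (vecV α β γ ⬝ᵥ x) • ℓ -
      (vecV α β γ ⬝ᵥ x) • ((circuitM0 α β γ : Matrix (Idx n) (Idx n) ℂ) *ᵥ ℓ) := by
    rw [circuitM0_mulVec, circuitM0_mulVec]
    module
  by_cases hφψ : φ = ψ
  · subst hφψ
    have h3 : (vecV α β γ ⬝ᵥ x) • ℓ ∈ otherWeights C χ := by
      rw [← sub_add_cancel ((vecV α β γ ⬝ᵥ x) • ℓ)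
        ((vecV α β γ ⬝ᵥ x) • ((circuitM0 α β γ : Matrix (Idx n) (Idx n) ℂ) *ᵥ ℓ)), ← hrel]
      exact Submodule.add_mem _ (mem_otherWeights h1 (Submodule.sub_mem _
        (Submodule.smul_mem _ _ hx) (Submodule.smul_mem _ _ hφ)))
        (Submodule.smul_mem _ _ (mem_otherWeights D.weight_ne D.mem'))
    exact (smul_eq_zero.mp (eq_zero_of_mem_otherWeights
      (Submodule.smul_mem _ _ D.mem) h3)).resolve_right D.ne_zero
  · have h3 : (vecV α β γ ⬝ᵥ ℓ) • x ∈ otherWeights C ψ := by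
      rw [← sub_add_cancel ((vecV α β γ ⬝ᵥ ℓ) • x)
        ((vecV α β γ ⬝ᵥ ℓ) • ((circuitM0 α β γ : Matrix (Idx n) (Idx n) ℂ) *ᵥ x)), hrel]
      exact Submodule.add_mem _ (Submodule.sub_mem _
        (Submodule.smul_mem _ _ (mem_otherWeights (Ne.symm h1) D.mem))
        (Submodule.smul_mem _ _ (mem_otherWeights (Ne.symm h2) D.mem')))
        (Submodule.smul_mem _ _ (mem_otherWeights hφψ hφ))
    have h4 := (smul_eq_zero.mp (eq_zero_of_mem_otherWeights
      (Submodule.smul_mem _ _ hx) h3)).resolve_left D.dot_ne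
    rw [h4, dotProduct_zero]

theorem circuitM_mulVec_mem_weightSpace (D : MonomialData α β γ C χ χ' ℓ) {k : Fin n}
    (hk : (γ k : ℂ) ≠ -1) {ψ : C → ℂ} {x : Idx n → ℂ} (hx : x ∈ weightSpace C ψ) :
    (circuitM γ k : Matrix (Idx n) (Idx n) ℂ) *ᵥ x ∈ weightSpace C ψ := by
  have hm := circuitM_mem_mon α β γ k
  by_cases hx0 : x = 0
  · rw [hx0, mulVec_zero]
    exact Submodule.zero_mem _
  obtain ⟨φ, hφ⟩ := D.exists_weight hm hx
  obtain ⟨φ₂, hφ₂⟩ := D.exists_weight hm hφ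
  by_cases hne : φ = ψ
  · rwa [hne] at hφ
  · have h1 := eq_neg_one_of_weight_ne (inv_ne_zero (γ k).ne_zero) hx0 hx hφ hφ₂
      (circuitM_quadratic γ k x) hne
    refine (hk ?_).elim
    rw [← inv_inv (γ k : ℂ), h1, inv_neg, inv_one]

theorem circuitM_mulVec_eq_smul (D : MonomialData α β γ C χ χ' ℓ) {k : Fin n}
    (hk : (γ k : ℂ) ≠ -1) {ψ : C → ℂ} {x : Idx n → ℂ} (hx : x ∈ weightSpace C ψ) (hx0 : x ≠ 0) :
    ∃ c : ℂ, (circuitM γ k : Matrix (Idx n) (Idx n) ℂ) *ᵥ x = c • x :=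
  D.mult_one ψ x _ hx (D.circuitM_mulVec_mem_weightSpace hk hx) hx0

theorem right_ne_zero (D : MonomialData α β γ C χ χ' ℓ) :
    (circuitM0 α β γ : Matrix (Idx n) (Idx n) ℂ) *ᵥ ℓ ≠ 0 := fun h =>
  D.ne_zero ((mulVec_eq_zero_iff _).mp h)

theorem circuitM_mulVec_mem_plane (D : MonomialData α β γ C χ χ' ℓ) {k : Fin n}
    (hk : (γ k : ℂ) ≠ -1) :
    ∀ w ∈ plane α β γ ℓ, (circuitM γ k : Matrix (Idx n) (Idx n) ℂ) *ᵥ w ∈ plane α β γ ℓ := by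
  obtain ⟨a, ha⟩ := D.circuitM_mulVec_eq_smul hk D.mem D.ne_zero
  obtain ⟨b, hb⟩ := D.circuitM_mulVec_eq_smul hk D.mem' D.right_ne_zero
  refine plane_induction ?_ ?_
  · rw [ha]; exact Submodule.smul_mem _ _ left_mem_plane
  · rw [hb]; exact Submodule.smul_mem _ _ right_mem_plane

theorem delta0_eq_neg_one (D : MonomialData α β γ C χ χ' ℓ) : delta0 α β γ = -1 := by
  obtain ⟨φ, hφ⟩ := D.exists_weight (circuitM0_mem_mon α β γ) D.mem'
  exact eq_neg_one_of_weight_ne (delta0_ne_zero α β γ) D.ne_zero D.mem D.mem' hφ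
    (circuitM0_quadratic α β γ ℓ) D.weight_ne

/-- In dimension at least four, the plane `⟨ℓ, M_0 ℓ⟩` and its image under the only `M_k` that can
move it form a system of imprimitivity for `Mon`. The reflections preserve its members: `M_0` maps the
plane to itself and fixes the image pointwise. -/
theorem eq_one (D : MonomialData α β γ C χ χ' ℓ)
    (hirr : ActsIrreducibly (Ref α β γ : Set (GL (Idx n) ℂ))) (h1 : AtMostOneNegOne α β γ) :
    n = 1 := by
  by_contra hn
  have h4 := four_le_two_pow hn
  set P := plane α β γ ℓ with hP
  set ℓ' := (circuitM0 α β γ : Matrix (Idx n) (Idx n) ℂ) *ᵥ ℓ with hℓ'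
  have hPtop : P ≠ ⊤ := by
    intro h
    refine span_triple_ne_top h4 ℓ ℓ ℓ' ?_
    rw [Set.insert_eq_of_mem (Set.mem_insert _ _)]
    exact h
  have hPbot : P ≠ ⊥ := (Submodule.ne_bot_iff _).mpr ⟨ℓ, left_mem_plane, D.ne_zero⟩
  obtain ⟨k, hγk⟩ : ∃ k, (γ k : ℂ) = -1 := by
    by_contra! hall
    exact hPtop (eq_top_of_root_mem γ (fun k => D.circuitM_mulVec_mem_plane (hall k))
      D.root_mem_plane)
  have hoth : ∀ l, l ≠ k → (γ l : ℂ) ≠ -1 := fun l hl hγl =>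
    hl (Option.some.inj (@h1 (some l) hγl (some k) hγk))
  set M := circuitM γ k with hM
  have hsq : ∀ x : Idx n → ℂ, (M : Matrix (Idx n) (Idx n) ℂ) *ᵥ
      ((M : Matrix (Idx n) (Idx n) ℂ) *ᵥ x) = x := by
    intro x
    rw [hM, circuitM_quadratic, hγk, inv_neg, inv_one, add_neg_cancel, zero_smul, zero_sub,
      neg_smul, one_smul, neg_neg]
  have hP' : ∀ w ∈ P, (M : Matrix (Idx n) (Idx n) ℂ) *ᵥ w ∈ translate M P := fun w hw =>
    mulVec_mem_translate.mpr hw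
  have hMM : translate M (translate M P) = P := by
    rw [← translate_mul]
    exact translate_eq_self fun w hw => by rwa [coe_mulVec_mul, hsq]
  have hl : ∀ l, l ≠ k → translate (circuitM γ l) P = P := fun l hlk =>
    translate_eq_self (D.circuitM_mulVec_mem_plane (hoth l hlk))
  have hl' : ∀ l, l ≠ k → translate (circuitM γ l) (translate M P) = translate M P := by
    intro l hlk
    rw [← translate_mul, circuitM_comm, translate_mul, hl l hlk]
  have hsum : P ⊔ translate M P = ⊤ := by
    refine eq_top_of_root_mem γ (fun l w hw => ?_) (Submodule.mem_sup_left D.root_mem_plane)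
    obtain ⟨x, hx, y, hy, rfl⟩ := Submodule.mem_sup.mp hw
    rw [mulVec_add]
    by_cases hlk : l = k
    · subst hlk
      exact Submodule.add_mem _ (Submodule.mem_sup_right (hP' x hx))
        (Submodule.mem_sup_left (mulVec_mem_of_translate_eq hMM hy))
    · exact Submodule.add_mem _ (Submodule.mem_sup_left (mulVec_mem_of_translate_eq (hl l hlk) hx))
        (Submodule.mem_sup_right (mulVec_mem_of_translate_eq (hl' l hlk) hy))
  have hspan : ∀ W : Submodule ℂ (Idx n → ℂ), ℓ ∈ W → ℓ' ∈ W →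
      (M : Matrix (Idx n) (Idx n) ℂ) *ᵥ ℓ ∈ W → (M : Matrix (Idx n) (Idx n) ℂ) *ᵥ ℓ' ∈ W →
      W = ⊤ := by
    intro W a1 a2 a3 a4
    rw [eq_top_iff, ← hsum]
    refine sup_le (Submodule.span_le.mpr ?_) fun w hw => ?_
    · rintro x (rfl | rfl)
      · exact a1
      · exact a2
    · have := plane_induction a3 a4 _ (mem_translate.mp hw)
      rwa [mulVec_inv_mulVec] at this
  have hMmon := circuitM_mem_mon α β γ k
  -- Three vectors do not span, so `M ℓ` and `M ℓ'` lie on lines other than those of `ℓ` and `ℓ'`.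
  have hdot : ∀ x ∈ ({ℓ, ℓ'} : Set (Idx n → ℂ)), ∀ ψ, x ∈ weightSpace C ψ →
      vecV α β γ ⬝ᵥ ((M : Matrix (Idx n) (Idx n) ℂ) *ᵥ x) = 0 := by
    intro x hx ψ hxψ
    obtain ⟨φ, hφ⟩ := D.exists_weight hMmon hxψ
    have hnot : (M : Matrix (Idx n) (Idx n) ℂ) *ᵥ x ∉ P := by
      intro hmem
      rcases hx with rfl | rfl
      · refine span_triple_ne_top h4 x ℓ' ((M : Matrix (Idx n) (Idx n) ℂ) *ᵥ ℓ') ?_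
        refine hspan _ (Submodule.subset_span (by simp)) (Submodule.subset_span (by simp))
          (Submodule.span_mono ?_ hmem) (Submodule.subset_span (by simp))
        rintro y (rfl | rfl) <;> simp [hℓ']
      · refine span_triple_ne_top h4 ℓ ℓ' ((M : Matrix (Idx n) (Idx n) ℂ) *ᵥ ℓ) ?_
        refine hspan _ (Submodule.subset_span (by simp)) (Submodule.subset_span (by simp))
          (Submodule.subset_span (by simp)) (Submodule.span_mono ?_ hmem)
        rintro y (rfl | rfl) <;> simp [hℓ']
    refine D.dot_eq_zero hφ ?_ ?_
    · rintro rfl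
      obtain ⟨c, hc⟩ := D.mult_one _ _ _ D.mem hφ D.ne_zero
      exact hnot (hc ▸ Submodule.smul_mem _ _ left_mem_plane)
    · rintro rfl
      obtain ⟨c, hc⟩ := D.mult_one _ _ _ D.mem' hφ D.right_ne_zero
      exact hnot (hc ▸ Submodule.smul_mem _ _ right_mem_plane)
  have hfix : ∀ w ∈ translate M P,
      (circuitM0 α β γ : Matrix (Idx n) (Idx n) ℂ) *ᵥ w = w := by
    intro w hw
    obtain ⟨a, b, hab⟩ := Submodule.mem_span_pair.mp (mem_translate.mp hw)
    rw [circuitM0_mulVec, ← mulVec_inv_mulVec M w, ← hab, mulVec_add, mulVec_smul, mulVec_smul,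
      dotProduct_add, dotProduct_smul, dotProduct_smul, hdot ℓ (by simp) χ D.mem,
      hdot ℓ' (by simp) χ' D.mem', smul_zero, smul_zero, add_zero, zero_smul, sub_zero]
  have himp : ∀ g ∈ Mon α β γ, (translate g P = P ∧ translate g (translate M P) = translate M P) ∨
      (translate g P = translate M P ∧ translate g (translate M P) = P) := by
    intro g hg
    induction hg using Subgroup.closure_induction with
    | mem g hg =>
      rcases hg with rfl | ⟨l, rfl⟩
      · exact Or.inl ⟨translate_eq_self D.circuitM0_mulVec_mem_plane,
          translate_eq_self fun w hw => by rwa [hfix w hw]⟩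
      · by_cases hlk : l = k
        · subst hlk
          exact Or.inr ⟨rfl, hMM⟩
        · exact Or.inl ⟨hl l hlk, hl' l hlk⟩
    | one => exact Or.inl ⟨translate_one _, translate_one _⟩
    | mul a b _ _ ha hb =>
      rw [translate_mul a b, translate_mul a b]
      rcases hb with ⟨hb1, hb2⟩ | ⟨hb1, hb2⟩ <;> rw [hb1, hb2]
      · exact ha
      · exact ha.symm.imp And.symm And.symm
    | inv a _ ha =>
      rcases ha with ⟨h1, h2⟩ | ⟨h1, h2⟩
      · exact Or.inl ⟨translate_inv_eq h1, translate_inv_eq h2⟩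
      · exact Or.inr ⟨translate_inv_eq h2, translate_inv_eq h1⟩
  have hst : Stable (Ref α β γ : Set (GL (Idx n) ℂ)) P := by
    refine stable_closure ?_
    rintro _ ⟨g, hg, rfl⟩ w hw
    rw [coe_mulVec_mul, coe_mulVec_mul]
    rcases himp _ (inv_mem hg) with ⟨h, -⟩ | ⟨h, -⟩
    · exact mulVec_mem_of_translate_eq (by simpa using translate_inv_eq h)
        (D.circuitM0_mulVec_mem_plane _ (mulVec_mem_of_translate_eq h hw))
    · rw [hfix _ (mulVec_mem_of_translate_eq h hw), mulVec_inv_mulVec]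
      exact hw
  exact (hirr.2 _ hst).elim hPbot hPtop

/-- For `n = 1` and `γ_1 ≠ -1`, `M_1` is diagonal and `M_0` antidiagonal in the basis `ℓ, M_0 ℓ`. The
number `v · (M_1 e)` is then the trace of `M_1`, and comparing with its explicit value gives
`α + β = 0`. -/
theorem add_eq_zero (D : MonomialData α β γ C χ χ' ℓ) (hn : n = 1) (hγ : ∀ k, (γ k : ℂ) ≠ -1) :
    (α : ℂ) + β = 0 := by
  subst hn
  have hδ := D.delta0_eq_neg_one
  have hγ0 := (γ 0).ne_zero
  have hα := α.ne_zero
  have hβ := β.ne_zero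
  obtain ⟨a, ha⟩ := D.circuitM_mulVec_eq_smul (hγ 0) D.mem D.ne_zero
  obtain ⟨b, hb⟩ := D.circuitM_mulVec_eq_smul (hγ 0) D.mem' D.right_ne_zero
  have hroots : ∀ (c : ℂ) (x : Idx 1 → ℂ), x ≠ 0 →
      (circuitM γ 0 : Matrix (Idx 1) (Idx 1) ℂ) *ᵥ x = c • x →
      c * c = (1 + (γ 0 : ℂ)⁻¹) * c - (γ 0 : ℂ)⁻¹ := by
    intro c x hx0 hx
    have h := circuitM_quadratic γ 0 x
    rw [hx, mulVec_smul, hx, smul_smul, smul_smul, ← sub_smul, ← sub_eq_zero, ← sub_smul] at h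
    exact sub_eq_zero.mp ((smul_eq_zero.mp h).resolve_right hx0)
  have ha2 := hroots a ℓ D.ne_zero ha
  have hb2 := hroots b _ D.right_ne_zero hb
  have he : (vecV α β γ ⬝ᵥ ℓ) • root 1 =
      ℓ - (circuitM0 α β γ : Matrix (Idx 1) (Idx 1) ℂ) *ᵥ ℓ := by
    rw [circuitM0_mulVec, sub_sub_cancel]
  have hv' : vecV α β γ ⬝ᵥ ((circuitM0 α β γ : Matrix (Idx 1) (Idx 1) ℂ) *ᵥ ℓ) =
      -(vecV α β γ ⬝ᵥ ℓ) := by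
    rw [circuitM0_mulVec, dotProduct_sub, dotProduct_smul, vecV_dotProduct_root, hδ, smul_eq_mul]
    ring
  have hMe : (vecV α β γ ⬝ᵥ ℓ) • ((circuitM γ 0 : Matrix (Idx 1) (Idx 1) ℂ) *ᵥ root 1) =
      a • ℓ - b • ((circuitM0 α β γ : Matrix (Idx 1) (Idx 1) ℂ) *ᵥ ℓ) := by
    rw [← mulVec_smul, he, mulVec_sub, ha, hb]
  have hab : a ≠ b := by
    -- Otherwise the cyclic vector `e` would be an eigenvector.
    rintro rfl
    have h1 : (circuitM γ 0 : Matrix (Idx 1) (Idx 1) ℂ) *ᵥ root 1 = a • root 1 := by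
      rw [← smul_sub, ← he, smul_comm] at hMe
      exact smul_right_injective _ D.dot_ne hMe
    have htop : (ℂ ∙ root 1) = ⊤ := by
      refine eq_top_of_root_mem γ (fun k w hw => ?_) (Submodule.mem_span_singleton_self _)
      obtain ⟨c, rfl⟩ := Submodule.mem_span_singleton.mp hw
      rw [Subsingleton.elim k 0, mulVec_smul, h1, smul_comm]
      exact Submodule.smul_mem _ _ hw
    obtain ⟨c, hc⟩ := Submodule.mem_span_singleton.mp
      (htop ▸ Submodule.mem_top (x := (Pi.single 0 1 : Idx 1 → ℂ)))
    exact single_zero_ne_smul_root c hc.symm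
  have hsum : a + b = 1 + (γ 0 : ℂ)⁻¹ := by
    refine mul_left_cancel₀ (sub_ne_zero.mpr hab) ?_
    linear_combination ha2 - hb2
  have hvMe : vecV α β γ ⬝ᵥ ((circuitM γ 0 : Matrix (Idx 1) (Idx 1) ℂ) *ᵥ root 1) = a + b := by
    have h := congrArg (fun x => vecV α β γ ⬝ᵥ x) hMe
    simp only [dotProduct_smul, dotProduct_sub, hv', smul_eq_mul] at h
    refine mul_left_cancel₀ D.dot_ne ?_
    linear_combination h
  have hupd : Function.update (1 : Idx 1) 0 0 = 0 := by
    ext1 j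
    rw [Subsingleton.elim j 0]
    simp
  have hkey := congrArg (fun x => vecV α β γ ⬝ᵥ x) (single_update_zero_eq γ (k := 0) (J := 1) rfl)
  simp only [hupd, dotProduct_sub, dotProduct_smul, dotProduct_single, mul_one, smul_eq_mul] at hkey
  rw [root] at hvMe
  rw [hvMe, hsum, vecV_one, hδ] at hkey
  simp only [vecV, if_true, Finset.univ_unique, Fin.default_eq_zero, Finset.prod_singleton,
    pow_one] at hkey
  simp only [delta0, Finset.univ_unique, Fin.default_eq_zero, Finset.prod_singleton] at hδ
  field_simp at hkey hδ
  refine mul_left_cancel₀ hγ0 ?_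
  linear_combination hkey + hδ

end MonomialData

end Monomial

/-! ### Irreducibility of the identity component and infinite order -/

section Main

variable {n : ℕ} [NeZero n]

theorem actsIrreducibly_ref_iff (α β : ℂˣ) (γ : Fin n → ℂˣ) :
    ActsIrreducibly (Ref α β γ : Set (GL (Idx n) ℂ)) ↔
      IrrCondition α β γ ∧ AtMostOneNegOne α β γ := by
  refine ⟨fun h => ⟨irrCondition_of_actsIrreducibly ⟨h.1, fun W hW => h.2 W fun g hg =>
    hW g (ref_le_mon α β γ hg)⟩, atMostOneNegOne_of_actsIrreducibly h⟩,
    fun h => actsIrreducibly_ref h.1 h.2⟩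

/-- If a normal subgroup `C` of `Mon` is reducible, a simple `C`-submodule `W` that is moved by `M_0`
meets its image, hence the hyperplane fixed by `M_0`, only in `0`; so `W` is a line of weight vectors. -/
theorem exists_weightVector_moved {α β : ℂˣ} {γ : Fin n → ℂˣ} {C : Subgroup (GL (Idx n) ℂ)}
    (hnorm : ∀ g ∈ Mon α β γ, ∀ c ∈ C, g * c * g⁻¹ ∈ C)
    (hirr : ActsIrreducibly (Ref α β γ : Set (GL (Idx n) ℂ)))
    {W : Submodule ℂ (Idx n → ℂ)} (hW : Stable (C : Set (GL (Idx n) ℂ)) W) (hbot : W ≠ ⊥)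
    (htop : W ≠ ⊤) : ∃ (χ : C → ℂ) (ℓ : Idx n → ℂ), ℓ ∈ weightSpace C χ ∧
      vecV α β γ ⬝ᵥ ℓ ≠ 0 ∧
      ∀ c : ℂ, (circuitM0 α β γ : Matrix (Idx n) (Idx n) ℂ) *ᵥ ℓ ≠ c • ℓ := by
  have hnorm' : ∀ g ∈ Mon α β γ, ∀ c ∈ C, g⁻¹ * c * g ∈ C := fun g hg c hc => by
    simpa using hnorm g⁻¹ (inv_mem hg) c hc
  obtain ⟨W₀, hle, hmin₀⟩ := exists_minStable_le hW hbot
  obtain ⟨g, hg, w, hw, hgw⟩ : ∃ g ∈ Mon α β γ, ∃ w ∈ W₀,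
      ((g * circuitM0 α β γ * g⁻¹ : GL (Idx n) ℂ) : Matrix (Idx n) (Idx n) ℂ) *ᵥ w ∉ W₀ := by
    by_contra! hcon
    have hst : Stable (Ref α β γ : Set (GL (Idx n) ℂ)) W₀ := by
      refine stable_closure ?_
      rintro _ ⟨g, hg, rfl⟩ w hw
      exact hcon g hg w hw
    rcases hirr.2 _ hst with h | h
    · exact hmin₀.1 h
    · exact htop (top_le_iff.mp (h ▸ hle))
  have hgi := inv_mem hg
  have hmin : MinStable (C : Set (GL (Idx n) ℂ)) (translate g⁻¹ W₀) :=
    hmin₀.translate (hnorm' _ hgi) (hnorm _ hgi)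
  set U := translate g⁻¹ W₀ with hU
  set ℓ := ((g⁻¹ : GL (Idx n) ℂ) : Matrix (Idx n) (Idx n) ℂ) *ᵥ w with hℓ
  have hℓU : ℓ ∈ U := mulVec_mem_translate.mpr hw
  have hMℓ : (circuitM0 α β γ : Matrix (Idx n) (Idx n) ℂ) *ᵥ ℓ ∉ U := by
    intro h
    rw [hU, mem_translate, inv_inv] at h
    rw [coe_mulVec_mul, coe_mulVec_mul] at hgw
    exact hgw h
  have hm := circuitM0_mem_mon α β γ
  have hker : ∀ x ∈ U, vecV α β γ ⬝ᵥ x = 0 → x = 0 := by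
    intro x hx hvx
    by_contra hx0
    have h1 : x ∈ translate (circuitM0 α β γ) U := by
      have := mulVec_mem_translate (g := circuitM0 α β γ).mpr hx
      rwa [circuitM0_mulVec, hvx, zero_smul, sub_zero] at this
    have h2 := (hmin.translate (hnorm' _ hm) (hnorm _ hm)).eq_of_mem hmin hx0 h1 hx
    exact hMℓ (mulVec_mem_of_translate_eq h2 hℓU)
  have hvℓ : vecV α β γ ⬝ᵥ ℓ ≠ 0 := by
    intro h
    apply hMℓ
    rw [hker ℓ hℓU h, mulVec_zero]
    exact U.zero_mem
  have hline : ∀ x ∈ U, x = (vecV α β γ ⬝ᵥ x / vecV α β γ ⬝ᵥ ℓ) • ℓ := by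
    intro x hx
    refine sub_eq_zero.mp (hker _ (U.sub_mem hx (U.smul_mem _ hℓU)) ?_)
    rw [dotProduct_sub, dotProduct_smul, smul_eq_mul, div_mul_cancel₀ _ hvℓ, sub_self]
  refine ⟨fun c => vecV α β γ ⬝ᵥ (((c : GL (Idx n) ℂ) : Matrix (Idx n) (Idx n) ℂ) *ᵥ ℓ) /
    vecV α β γ ⬝ᵥ ℓ, ℓ, fun c => hline _ (hmin.2.1 c c.2 ℓ hℓU), hvℓ, fun c hc => ?_⟩
  exact hMℓ (hc ▸ U.smul_mem c hℓU)

/-- The hypothesis on `n = 1` excludes the only monomial configuration that can occur. -/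
theorem actsIrreducibly_of_finite_index {α β : ℂˣ} {γ : Fin n → ℂˣ} {C : Subgroup (GL (Idx n) ℂ)}
    (hle : C ≤ Mon α β γ) (hnorm : ∀ g ∈ Mon α β γ, ∀ c ∈ C, g * c * g⁻¹ ∈ C)
    (hidx : C.relIndex (Mon α β γ) ≠ 0)
    (hirr : ActsIrreducibly (Ref α β γ : Set (GL (Idx n) ℂ)))
    (hexc : n = 1 → delta0 α β γ = -1 → (∀ k, (γ k : ℂ) ≠ -1) ∧ (α : ℂ) * (β : ℂ)⁻¹ ≠ -1)
    (hinf : Infinite (Mon α β γ)) : ActsIrreducibly (C : Set (GL (Idx n) ℂ)) := by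
  refine ⟨inferInstance, fun W hW => ?_⟩
  by_contra! hcon
  obtain ⟨χ, ℓ, hℓ, hvℓ, hmove⟩ := exists_weightVector_moved hnorm hirr hW hcon.1 hcon.2
  by_cases hmult : ∀ (ψ : C → ℂ) (x y : Idx n → ℂ), x ∈ weightSpace C ψ → y ∈ weightSpace C ψ →
      x ≠ 0 → ∃ c : ℂ, y = c • x
  · have hm := circuitM0_mem_mon α β γ
    obtain ⟨χ', hχ'⟩ := exists_translate_weightSpace (g := circuitM0 α β γ)
      (fun c hc => by simpa using hnorm _ (inv_mem hm) c hc) (hnorm _ hm) χ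
    have hℓ' := mulVec_mem_of_translate_eq hχ' hℓ
    have D : MonomialData α β γ C χ χ' ℓ :=
      { norm := hnorm
        mult_one := hmult
        mem := hℓ
        mem' := hℓ'
        weight_ne := by
          rintro rfl
          obtain ⟨c, hc⟩ := hmult _ _ _ hℓ hℓ' fun h => hvℓ (by rw [h, dotProduct_zero])
          exact hmove c hc
        dot_ne := hvℓ }
    have hn := D.eq_one hirr ((actsIrreducibly_ref_iff α β γ).mp hirr).2
    obtain ⟨h1, h2⟩ := hexc hn D.delta0_eq_neg_one
    refine h2 ?_
    rw [eq_neg_of_add_eq_zero_left (D.add_eq_zero hn h1), neg_mul, mul_inv_cancel₀ β.ne_zero]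
  · push Not at hmult
    obtain ⟨ψ, x, y, hx, hy, hx0, hxy⟩ := hmult
    have := finite_mon_of_scalar hle hidx (weightSpace_eq_top hnorm hirr hx hy hx0 hxy)
    exact not_finite (Mon α β γ)

/-- For `δ₀ = 1` the matrix `M_0` is a transvection, of infinite order. -/
theorem infinite_mon {α β : ℂˣ} {γ : Fin n → ℂˣ} (hv : vecV α β γ ≠ 0)
    (hδ : delta0 α β γ = 1) : Infinite (Mon α β γ) := by
  have hpow : ∀ (m : ℕ) (w : Idx n → ℂ),
      ((circuitM0 α β γ ^ m : GL (Idx n) ℂ) : Matrix (Idx n) (Idx n) ℂ) *ᵥ w =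
        w - ((m : ℂ) * (vecV α β γ ⬝ᵥ w)) • root n := by
    intro m w
    induction m with
    | zero => simp
    | succ m ih =>
      rw [pow_succ', coe_mulVec_mul, ih, circuitM0_mulVec, dotProduct_sub, dotProduct_smul,
        vecV_dotProduct_root, hδ, sub_self, smul_zero, sub_zero]
      push_cast
      module
  by_contra hfin
  rw [not_infinite_iff_finite] at hfin
  obtain ⟨m, hm, hm1⟩ := isOfFinOrder_iff_pow_eq_one.mp
    (isOfFinOrder_of_finite (⟨circuitM0 α β γ, circuitM0_mem_mon α β γ⟩ : Mon α β γ))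
  have h1 : circuitM0 α β γ ^ m = 1 := congrArg Subtype.val hm1
  refine hv (funext fun J => ?_)
  have h2 := hpow m (Pi.single J 1)
  rw [h1, Units.val_one, one_mulVec, eq_comm, sub_eq_self, dotProduct_single, mul_one] at h2
  have h3 := (smul_eq_zero.mp h2).resolve_right root_ne_zero
  exact (mul_eq_zero.mp h3).resolve_left (Nat.cast_ne_zero.mpr hm.ne')

end Main

end LauricellaFC

theorem mainTheorem5 (n : ℕ) [NeZero n] (α β : ℂˣ) (γ : Fin n → ℂˣ) :
    (LauricellaFC.ActsIrreducibly (LauricellaFC.Ref α β γ : Set (GL (LauricellaFC.Idx n) ℂ)) ↔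
      LauricellaFC.IrrCondition α β γ ∧ LauricellaFC.AtMostOneNegOne α β γ) ∧
    (LauricellaFC.ActsIrreducibly (LauricellaFC.Ref α β γ : Set (GL (LauricellaFC.Idx n) ℂ)) →
      ((n = 1 → LauricellaFC.delta0 α β γ = -1 →
          (∀ k, (γ k : ℂ) ≠ -1) ∧ (α : ℂ) * (β : ℂ)⁻¹ ≠ -1) →
        Infinite (LauricellaFC.Mon α β γ) →
        LauricellaFC.ActsIrreducibly
          (LauricellaFC.identityComponent (LauricellaFC.Mon α β γ))) ∧
      (LauricellaFC.delta0 α β γ = 1 → Infinite (LauricellaFC.Mon α β γ))) := by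
  refine ⟨LauricellaFC.actsIrreducibly_ref_iff α β γ, fun hirr => ⟨fun hexc hinf => ?_, fun hδ => ?_⟩⟩
  · obtain ⟨C, hC, hle, hnorm, hidx⟩ :=
      LauricellaFC.exists_subgroup_identityComponent (LauricellaFC.Mon α β γ)
    rw [← hC]
    exact LauricellaFC.actsIrreducibly_of_finite_index hle hnorm hidx hirr hexc hinf
  · exact LauricellaFC.infinite_mon
      (LauricellaFC.vecV_ne_zero ((LauricellaFC.actsIrreducibly_ref_iff α β γ).mp hirr).1) hδ
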